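/- Fix integers $K\ge 1$ and $n_0\ge K$, a probability vector $p^*=(p^*_1,\dots,p^*_K)$ with $p^*_k<1$ for every $k$ and with all $p^*_kn_0$ integers, $q^*\in(0,1]$, $\gamma,\alpha\in(0,1]$, and put $\theta^*=\frac{\gamma}{\gamma+\alpha(1-\gamma)}\in(0,1]$. Every node $i$ has a group $g_i\in\{1,\dots,K\}$. The network $G_0$ has $n_0$ nodes, $p^*_kn_0$ of them in group $k$, each of initial degree one. Given $G_0,\dots,G_{t-1}$, the network $G_t$ arises as follows; all degrees $d_i$ are those in $G_{t-1}$, and a loop counts twice. With probability $q^*$ (vertex-step, $v_t=1$) a new node $w$ arrives, in group $k$ with probability $p^*_k$; otherwise (edge-step, $v_t=0$) an old node $w$ is drawn with probability $d_w/\sum_i d_i$. Then an old node $u$ (possibly $u=w$ in an edge-step) is proposed with probability $d_u/\sum_i d_i$. A proposal is accepted with probability $1$ if $g_u=g_w$ and with probability $\gamma$ otherwise. After each rejection a new old node $u$ is proposed, with probability $\alpha\, d_u/\sum_{g_i=g_w}d_i$ if $g_u=g_w$ and $(1-\alpha)\,d_u/\sum_{g_i\ne g_w}d_i$ otherwise,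 until a proposal is accepted; then the edge $e_t=(w,u)$ is added. Let $D^k_t=\sum_{g_i=k}d_i(t)$, where $d_i(t)$ is the degree of node $i$ in $G_t$, let $P^k_t=\frac{D^k_{t-1}}{2(t-1)+n_0}$, and let $w,u$ in the indicators below be the endpoints of $e_t=(w,u)$. The likelihood of the fully observed evolution $G_0,\dots,G_T$ at $\psi=(\theta,\{p_k\}_{k=1}^K,q)$, with $\theta\in(0,1]$, $p$ a probability vector and $q\in[0,1]$, is \begin{align*} L(\psi)=\prod_{t=1}^T\prod_{k=1}^K&\big[qp_k\big(P^k_t+(1-\theta)(1-P^k_t)\big)\big]^{\mathbf 1\{v_t=1,\,g_w=g_u=k\}}\big[qp_k(1-P^k_t)\theta\big]^{\mathbf 1\{v_t=1,\,g_w=k,\,g_u\ne k\}}\\ &\times\big[(1-q)P^k_t\big(P^k_t+(1-\theta)(1-P^k_t)\big)\big]^{\mathbf 1\{v_t=0,\,g_w=g_u=k\}}\big[(1-q)P^k_t(1-P^k_t)\theta\big]^{\mathbf 1\{v_t=0,\,g_w=k,\,g_u\ne k\}}, \end{align*} and $\log L_2(\theta)$ denotes the logarithm of this product with the factors $qp_k$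 and $(1-q)$ removed, that is, \begin{align*} \log L_2(\theta)=\sum_{t=1}^T\sum_{k=1}^K\Big[&\mathbf 1\{v_t=1,\,g_w=g_u=k\}\log\big(P^k_t+(1-\theta)(1-P^k_t)\big)+\mathbf 1\{v_t=1,\,g_w=k,\,g_u\ne k\}\log\big((1-P^k_t)\theta\big)\\ &+\mathbf 1\{v_t=0,\,g_w=g_u=k\}\log\big(P^k_t(P^k_t+(1-\theta)(1-P^k_t))\big)+\mathbf 1\{v_t=0,\,g_w=k,\,g_u\ne k\}\log\big(P^k_t(1-P^k_t)\theta\big)\Big]. \end{align*} Let $$\hat p_k=\frac{\sum_{t=1}^T\mathbf 1\{v_t=1,\,g_w=k\}}{\sum_{t=1}^T v_t},\qquad \hat q=\frac1T\sum_{t=1}^T v_t,\qquad \hat\theta\in\arg\max_{\theta\in(0,1]}\log L_2(\theta),$$ where $\hat\theta$ is arbitrary if there is no maximiser, and $\hat\psi=\hat\psi_T=(\hat\theta,\{\hat p_k\}_{k=1}^K,\hat q)$. Then, almost surely, for all sufficiently large $T$ a maximiser $\hat\theta$ exists and $\hat\psi_T$ is the unique maximum likelihood estimate (the unique maximiser of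 $L$), and $$\hat\psi_T\longrightarrow\psi^*=(\theta^*,\{p^*_k\}_{k=1}^K,q^*)\qquad(T\to\infty).$$ -/

import Mathlib

open MeasureTheory Filter Topology
open scoped BigOperators

namespace KPA

/-- A finite multigraph whose nodes `0, …, numNodes - 1` carry a group label in `Fin K`.
The first `initNodes` nodes are those of the initial graph. Values of `group` at numbers
`≥ numNodes` are irrelevant. `edges` lists the edges `(w, u)` added so far, latest first. -/
structure Network (K : ℕ) where
  initNodes : ℕ
  numNodes : ℕ
  group : ℕ → Fin K
  edges : List (ℕ × ℕ)

/-- One step of the evolution. `vertexStep k u`: a new node of group `k` arrives and is joined to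
the old node `u`. `edgeStep w u`: the new edge `(w, u)` joins two old nodes. -/
inductive Step (K : ℕ) where
  | vertexStep (k : Fin K) (u : ℕ) : Step K
  | edgeStep (w u : ℕ) : Step K

/-- `v = 1`, that is, the step is a vertex-step. -/
def Step.isVertex {K : ℕ} : Step K → Bool
  | .vertexStep _ _ => true
  | .edgeStep _ _ => false

namespace Network

variable {K : ℕ}

/-- The initial graph: `n₀` nodes, the `i`-th one in group `g₀ i`, and no edge yet. -/
def initial (n₀ : ℕ) (g₀ : ℕ → Fin K) : Network K := ⟨n₀, n₀, g₀, []⟩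

/-- The graph after a step. In a vertex-step the new node gets the first unused number. -/
def add (G : Network K) : Step K → Network K
  | .vertexStep k u =>
      ⟨G.initNodes, G.numNodes + 1, Function.update G.group G.numNodes k,
        (G.numNodes, u) :: G.edges⟩
  | .edgeStep w u => ⟨G.initNodes, G.numNodes, G.group, (w, u) :: G.edges⟩

/-- The degree of node `i`. Each initial node starts with degree one; every edge contributes one
to each of its two endpoints (a loop contributes two). -/
def degree (G : Network K) (i : ℕ) : ℕ :=
  (if i < G.initNodes then 1 else 0) +
    (G.edges.map fun e => (if e.1 = i then 1 else 0) + (if e.2 = i then 1 else 0)).sum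

/-- The sum of all degrees. -/
def totalDegree (G : Network K) : ℕ := ∑ i ∈ Finset.range G.numNodes, G.degree i

/-- `D^k`, the sum of the degrees of the nodes of group `k`. -/
def groupDegree (G : Network K) (k : Fin K) : ℕ :=
  ∑ i ∈ Finset.range G.numNodes, if G.group i = k then G.degree i else 0

/-- The sum of the degrees of the nodes outside group `k`. -/
def otherDegree (G : Network K) (k : Fin K) : ℕ :=
  ∑ i ∈ Finset.range G.numNodes, if G.group i = k then 0 else G.degree i

/-- Group of the first endpoint `w` of the edge that the step `s` adds to `G`. -/
def wGroup (G : Network K) : Step K → Fin K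
  | .vertexStep k _ => k
  | .edgeStep w _ => G.group w

/-- Group of the second endpoint `u` of the edge that the step `s` adds to `G`. -/
def uGroup (G : Network K) : Step K → Fin K
  | .vertexStep _ u => G.group u
  | .edgeStep _ u => G.group u

/-- The graph `G_t` obtained from `G₀` by the steps `s 0, …, s (t - 1)`; so `s t` is the step
that leads from `G_t` to `G_{t+1}`. -/
def run (G₀ : Network K) (s : ℕ → Step K) : ℕ → Network K
  | 0 => G₀
  | t + 1 => (run G₀ s t).add (s t)

/-! ### The connection mechanism -/

/-- Probability that `w`, of group `k`, accepts the proposed node `u`: one within the group and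
`γ` otherwise. -/
noncomputable def accept (γ : ℝ) (G : Network K) (k : Fin K) (u : ℕ) : ℝ :=
  if G.group u = k then 1 else γ

/-- Preferential attachment: probability that the old node `u` is drawn. Used for the first
proposal, and for the choice of `w` in an edge-step. -/
noncomputable def prefProb (G : Network K) (u : ℕ) : ℝ :=
  (G.degree u : ℝ) / (G.totalDegree : ℝ)

/-- Probability that `u` is proposed to a node of group `k` in an attempt after the first one. -/
noncomputable def reproposeProb (α : ℝ) (G : Network K) (k : Fin K) (u : ℕ) : ℝ :=
  if G.group u = k then α * ((G.degree u : ℝ) / (G.groupDegree k : ℝ))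
  else (1 - α) * ((G.degree u : ℝ) / (G.otherDegree k : ℝ))

/-- Probability that the first proposal is rejected. -/
noncomputable def firstReject (γ : ℝ) (G : Network K) (k : Fin K) : ℝ :=
  ∑ u ∈ Finset.range G.numNodes, G.prefProb u * (1 - G.accept γ k u)

/-- Probability that a given later proposal is rejected. -/
noncomputable def laterReject (γ α : ℝ) (G : Network K) (k : Fin K) : ℝ :=
  ∑ u ∈ Finset.range G.numNodes, G.reproposeProb α k u * (1 - G.accept γ k u)

/-- Probability that a node of group `k` ends up connected to `u`: either the first proposal is
`u` and is accepted, or the first proposal and `j` later ones are rejected and the next proposal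
is `u` and is accepted, for some `j`. -/
noncomputable def connectProb (γ α : ℝ) (G : Network K) (k : Fin K) (u : ℕ) : ℝ :=
  G.prefProb u * G.accept γ k u +
    ∑' j : ℕ, G.firstReject γ k * G.laterReject γ α k ^ j *
      (G.reproposeProb α k u * G.accept γ k u)

/-- Conditional probability, given the present graph `G`, that `s` is the next step. -/
noncomputable def stepProb (γ α : ℝ) (p : Fin K → ℝ) (q : ℝ) (G : Network K) : Step K → ℝ
  | .vertexStep k u => if u < G.numNodes then q * p k * G.connectProb γ α k u else 0
  | .edgeStep w u =>
      if w < G.numNodes ∧ u < G.numNodes then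
        (1 - q) * G.prefProb w * G.connectProb γ α (G.group w) u
      else 0

end Network

/-- The random steps `ξ 0, ξ 1, …` drive the network model with initial graph `G₀`: conditionally
on the steps before time `T`, the next step has law `stepProb` at the current graph. -/
structure IsKPAModel {K : ℕ} {Ω : Type*} [MeasurableSpace Ω] (μ : Measure Ω) (G₀ : Network K)
    (γ α : ℝ) (p : Fin K → ℝ) (q : ℝ) (ξ : ℕ → Ω → Step K) : Prop where
  measurableSet_eq : ∀ (t : ℕ) (s : Step K), MeasurableSet {ω | ξ t ω = s}
  law : ∀ (T : ℕ) (s : ℕ → Step K),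
    μ.real {ω | ∀ t < T + 1, ξ t ω = s t} =
      μ.real {ω | ∀ t < T, ξ t ω = s t} * (G₀.run s T).stepProb γ α p q (s T)

/-! ### Estimators from the fully observed evolution -/

section Estimation

variable {K : ℕ}

/-- `P^k_{t+1} = D^k_t / (2 t + n₀)`. -/
noncomputable def share (G₀ : Network K) (s : ℕ → Step K) (t : ℕ) (k : Fin K) : ℝ :=
  ((G₀.run s t).groupDegree k : ℝ) / (2 * (t : ℝ) + (G₀.initNodes : ℝ))

/-- At time `t + 1` a step of the kind `v` adds an edge with both endpoints in group `k`. -/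
def SameAt (G₀ : Network K) (s : ℕ → Step K) (v : Bool) (k : Fin K) (t : ℕ) : Prop :=
  (s t).isVertex = v ∧ (G₀.run s t).wGroup (s t) = k ∧ (G₀.run s t).uGroup (s t) = k

/-- At time `t + 1` a step of the kind `v` adds an edge `(w, u)` with `w` in group `k` and `u`
in another group. -/
def DiffAt (G₀ : Network K) (s : ℕ → Step K) (v : Bool) (k : Fin K) (t : ℕ) : Prop :=
  (s t).isVertex = v ∧ (G₀.run s t).wGroup (s t) = k ∧ (G₀.run s t).uGroup (s t) ≠ k

open Classical in
/-- The partial log-likelihood `log L₂ (θ | G_0, …, G_T)`. -/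
noncomputable def logL2 (G₀ : Network K) (s : ℕ → Step K) (T : ℕ) (θ : ℝ) : ℝ :=
  ∑ t ∈ Finset.range T, ∑ k : Fin K,
    ((if SameAt G₀ s true k t then
        Real.log (share G₀ s t k + (1 - θ) * (1 - share G₀ s t k)) else 0) +
      (if DiffAt G₀ s true k t then
        Real.log ((1 - share G₀ s t k) * θ) else 0) +
      (if SameAt G₀ s false k t then
        Real.log (share G₀ s t k * (share G₀ s t k + (1 - θ) * (1 - share G₀ s t k))) else 0) +
      (if DiffAt G₀ s false k t then
        Real.log (share G₀ s t k * (1 - share G₀ s t k) * θ) else 0))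

open Classical in
/-- The full likelihood `L (θ, p, q | G_0, …, G_T)`. -/
noncomputable def likelihood (G₀ : Network K) (s : ℕ → Step K) (T : ℕ)
    (ψ : ℝ × (Fin K → ℝ) × ℝ) : ℝ :=
  ∏ t ∈ Finset.range T, ∏ k : Fin K,
    ((if SameAt G₀ s true k t then
        ψ.2.2 * ψ.2.1 k * (share G₀ s t k + (1 - ψ.1) * (1 - share G₀ s t k)) else 1) *
      (if DiffAt G₀ s true k t then
        ψ.2.2 * ψ.2.1 k * ((1 - share G₀ s t k) * ψ.1) else 1) *
      (if SameAt G₀ s false k t then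
        (1 - ψ.2.2) * (share G₀ s t k *
          (share G₀ s t k + (1 - ψ.1) * (1 - share G₀ s t k))) else 1) *
      (if DiffAt G₀ s false k t then
        (1 - ψ.2.2) * (share G₀ s t k * (1 - share G₀ s t k) * ψ.1) else 1))

/-- The parameters `(θ, p, q)` with `θ ∈ (0, 1]`, `p` a probability vector, and `q ∈ [0, 1]`. -/
def paramSpace (K : ℕ) : Set (ℝ × (Fin K → ℝ) × ℝ) :=
  {ψ | ψ.1 ∈ Set.Ioc (0 : ℝ) 1 ∧ ((∀ k, 0 ≤ ψ.2.1 k) ∧ ∑ k, ψ.2.1 k = 1) ∧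
    ψ.2.2 ∈ Set.Icc (0 : ℝ) 1}

/-- `ψ` is the unique maximum likelihood estimate given `G_0, …, G_T`. -/
def IsUniqueMLE (G₀ : Network K) (s : ℕ → Step K) (T : ℕ) (ψ : ℝ × (Fin K → ℝ) × ℝ) : Prop :=
  ψ ∈ paramSpace K ∧
    ∀ ψ' ∈ paramSpace K, ψ' ≠ ψ → likelihood G₀ s T ψ' < likelihood G₀ s T ψ

/-- `θ` maximises `log L₂` over `(0, 1]`. -/
def IsThetaHat (G₀ : Network K) (s : ℕ → Step K) (T : ℕ) (θ : ℝ) : Prop :=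
  θ ∈ Set.Ioc (0 : ℝ) 1 ∧ ∀ θ' ∈ Set.Ioc (0 : ℝ) 1, logL2 G₀ s T θ' ≤ logL2 G₀ s T θ

/-- Fraction of the new nodes up to time `T` that belong to group `k`. -/
noncomputable def pHat (G₀ : Network K) (s : ℕ → Step K) (T : ℕ) (k : Fin K) : ℝ :=
  (∑ t ∈ Finset.range T,
      if (s t).isVertex = true ∧ (G₀.run s t).wGroup (s t) = k then (1 : ℝ) else 0) /
    ∑ t ∈ Finset.range T, if (s t).isVertex = true then (1 : ℝ) else 0

/-- Fraction of vertex-steps up to time `T`. -/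
noncomputable def qHat (s : ℕ → Step K) (T : ℕ) : ℝ :=
  (∑ t ∈ Finset.range T, if (s t).isVertex = true then (1 : ℝ) else 0) / (T : ℝ)

end Estimation

end KPA

/-! Summing the geometric series of rejected proposals shows that a node of group k is joined to
another group with conditional probability θ* x, where x = 1 - P^k is the degree share outside group
k (`sum_connectProb_mul_ite`).

The likelihood is the product of a multinomial likelihood in the arrival law (q p_1, ..., q p_K, 1 -
q) and of L₂(θ) (`RegularPath.likelihood_eq`). The first factor is maximised exactly by the
empirical law (`prod_lt_prod_empirical`), which is the one given by p̂ and q̂. The function log L₂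
is concave, and strictly so once some edge joins two groups.

Consistency of θ̂ comes from the score. Its conditional mean at θ is (θ* - θ)/θ · W with W ≥ q (1 -
max p_k) (`Network.Reachable.exists_stepMean_scoreStat`): a new node chooses its group independently
of the degrees, so W stays away from zero however the shares evolve, and their convergence is never
needed. For a bounded statistic with such a drift, exponential moments and Borel–Cantelli fix the
sign of the sums for large T (`IsKPAModel.ae_eventually_sum_neg`). Hence the score is eventually
positive at every rational below θ* and negative at every rational in (θ*, 1), and concavity traps
θ̂ in between. The same drift lemma, applied to shifted statistics, gives the law of large numbers
behind p̂ and q̂. -/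

namespace KPA

/-! ### Degree recursions and reachable graphs -/

namespace Network

variable {K : ℕ}

/-- The first endpoint of the edge that a step adds. -/
def wNode (G : Network K) : Step K → ℕ
  | .vertexStep _ _ => G.numNodes
  | .edgeStep w _ => w

/-- The second endpoint of the edge that a step adds. -/
def uNode : Step K → ℕ
  | .vertexStep _ u => u
  | .edgeStep _ u => u

/-- The step joins nodes that are present in the graph. -/
def Feasible (G : Network K) : Step K → Prop
  | .vertexStep _ u => u < G.numNodes
  | .edgeStep w u => w < G.numNodes ∧ u < G.numNodes

/-- The sum of the degrees of the nodes whose group satisfies `P`. -/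
def labelDegree (G : Network K) (P : Fin K → Prop) [DecidablePred P] : ℕ :=
  ∑ i ∈ Finset.range G.numNodes, if P (G.group i) then G.degree i else 0

lemma wNode_vertexStep (G : Network K) (k : Fin K) (u : ℕ) :
    G.wNode (.vertexStep k u) = G.numNodes := rfl

lemma wNode_edgeStep (G : Network K) (w u : ℕ) : G.wNode (.edgeStep w u) = w := rfl

lemma uNode_vertexStep (k : Fin K) (u : ℕ) : uNode (.vertexStep k u) = u := rfl

lemma uNode_edgeStep (w u : ℕ) : uNode (.edgeStep w u : Step K) = u := rfl

lemma wGroup_vertexStep (G : Network K) (k : Fin K) (u : ℕ) :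
    G.wGroup (.vertexStep k u) = k := rfl

lemma wGroup_edgeStep (G : Network K) (w u : ℕ) : G.wGroup (.edgeStep w u) = G.group w := rfl

lemma uGroup_vertexStep (G : Network K) (k : Fin K) (u : ℕ) :
    G.uGroup (.vertexStep k u) = G.group u := rfl

lemma uGroup_edgeStep (G : Network K) (w u : ℕ) : G.uGroup (.edgeStep w u) = G.group u := rfl

lemma degree_add (G : Network K) (s : Step K) (i : ℕ) :
    (G.add s).degree i =
      G.degree i + ((if G.wNode s = i then 1 else 0) + (if uNode s = i then 1 else 0)) := by
  cases s with
  | vertexStep k u =>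
    rw [wNode_vertexStep, uNode_vertexStep]
    unfold degree
    rw [show (G.add (.vertexStep k u)).edges = (G.numNodes, u) :: G.edges from rfl,
      show (G.add (.vertexStep k u)).initNodes = G.initNodes from rfl, List.map_cons,
      List.sum_cons]
    ring
  | edgeStep w u =>
    rw [wNode_edgeStep, uNode_edgeStep]
    unfold degree
    rw [show (G.add (.edgeStep w u)).edges = (w, u) :: G.edges from rfl,
      show (G.add (.edgeStep w u)).initNodes = G.initNodes from rfl, List.map_cons,
      List.sum_cons]
    ring

/-- One recursion serves the total, group and complementary degrees. By `hG` the number given to a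
new node carries no degree yet, so that node counts only through its first edge. -/
lemma labelDegree_add (G : Network K) (P : Fin K → Prop) [DecidablePred P] {s : Step K}
    (hs : G.Feasible s) (hG : ∀ i, G.numNodes ≤ i → G.degree i = 0) :
    (G.add s).labelDegree P = G.labelDegree P +
      ((if P (G.wGroup s) then 1 else 0) + (if P (G.uGroup s) then 1 else 0)) := by
  have key : ∀ v < G.numNodes, (∑ i ∈ Finset.range G.numNodes,
      if P (G.group i) then (if v = i then 1 else 0) else 0) = if P (G.group v) then 1 else 0 := by
    intro v hv
    rw [Finset.sum_eq_single v]
    · simp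
    · intro b _ hb
      simp [Ne.symm hb]
    · intro h
      exact absurd (Finset.mem_range.2 hv) h
  cases s with
  | vertexStep k u =>
    have hu : u < G.numNodes := hs
    have e : ∀ i ∈ Finset.range G.numNodes,
        (if P ((G.add (.vertexStep k u)).group i) then (G.add (.vertexStep k u)).degree i else 0) =
          (if P (G.group i) then G.degree i else 0) +
            (if P (G.group i) then (if u = i then 1 else 0) else 0) := by
      intro i hi
      have hi' := Finset.mem_range.1 hi
      rw [degree_add]
      have : (G.add (.vertexStep k u)).group i = G.group i := by
        simp [add, Function.update_of_ne hi'.ne]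
      rw [this, wNode_vertexStep, uNode_vertexStep, if_neg hi'.ne']
      by_cases hP : P (G.group i) <;> simp [hP]
    have e2 : (G.add (.vertexStep k u)).numNodes = G.numNodes + 1 := rfl
    rw [labelDegree, e2, Finset.sum_range_succ, Finset.sum_congr rfl e, Finset.sum_add_distrib,
      key u hu, degree_add, hG _ le_rfl]
    have : (G.add (.vertexStep k u)).group G.numNodes = k := by simp [add]
    rw [this, wNode_vertexStep, uNode_vertexStep, wGroup_vertexStep, uGroup_vertexStep,
      if_neg hu.ne, labelDegree]
    simp only [if_true, zero_add, add_zero]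
    ring
  | edgeStep w u =>
    obtain ⟨hw, hu⟩ : w < G.numNodes ∧ u < G.numNodes := hs
    have e : ∀ i ∈ Finset.range G.numNodes,
        (if P ((G.add (.edgeStep w u)).group i) then (G.add (.edgeStep w u)).degree i else 0) =
          (if P (G.group i) then G.degree i else 0) +
            ((if P (G.group i) then (if w = i then 1 else 0) else 0) +
            (if P (G.group i) then (if u = i then 1 else 0) else 0)) := by
      intro i hi
      rw [degree_add]
      have : (G.add (.edgeStep w u)).group i = G.group i := rfl
      rw [this, wNode_edgeStep, uNode_edgeStep]
      by_cases hP : P (G.group i) <;> simp [hP]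
    have e2 : (G.add (.edgeStep w u)).numNodes = G.numNodes := rfl
    rw [labelDegree, e2, Finset.sum_congr rfl e, Finset.sum_add_distrib, Finset.sum_add_distrib,
      key u hu, key w hw]
    rfl

lemma totalDegree_eq_labelDegree (G : Network K) :
    G.totalDegree = G.labelDegree fun _ => True := by
  simp [totalDegree, labelDegree]

lemma groupDegree_eq_labelDegree (G : Network K) (k : Fin K) :
    G.groupDegree k = G.labelDegree (· = k) := rfl

lemma otherDegree_eq_labelDegree (G : Network K) (k : Fin K) :
    G.otherDegree k = G.labelDegree (· ≠ k) := by
  unfold otherDegree labelDegree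
  refine Finset.sum_congr rfl fun i _ => ?_
  by_cases h : G.group i = k <;> simp [h]

lemma groupDegree_add_otherDegree (G : Network K) (k : Fin K) :
    G.groupDegree k + G.otherDegree k = G.totalDegree := by
  unfold groupDegree otherDegree totalDegree
  rw [← Finset.sum_add_distrib]
  refine Finset.sum_congr rfl fun i _ => ?_
  split_ifs <;> simp

lemma sum_groupDegree (G : Network K) : ∑ k, G.groupDegree k = G.totalDegree := by
  unfold groupDegree totalDegree
  rw [Finset.sum_comm]
  simp

/-- The properties that every graph reachable in `T` steps with positive probability has. -/
structure Reachable (p : Fin K → ℝ) (n₀ T : ℕ) (G : Network K) : Prop where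
  degree_eq_zero : ∀ i, G.numNodes ≤ i → G.degree i = 0
  totalDegree_eq : G.totalDegree = 2 * T + n₀
  group_ne_zero : ∀ i < G.numNodes, p (G.group i) ≠ 0
  groupDegree_pos : ∀ k, p k ≠ 0 → 0 < G.groupDegree k
  otherDegree_pos : ∀ k, 0 < G.otherDegree k

lemma feasible_of_stepProb_ne_zero {γ α q : ℝ} {p : Fin K → ℝ} {G : Network K} {s : Step K}
    (h : G.stepProb γ α p q s ≠ 0) : G.Feasible s := by
  cases s with
  | vertexStep k u =>
    by_contra hu
    exact h (if_neg hu)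
  | edgeStep w u =>
    by_contra hu
    exact h (if_neg hu)

lemma Reachable.wGroup_ne_zero {γ α q : ℝ} {p : Fin K → ℝ} {n₀ T : ℕ} {G : Network K} {s : Step K}
    (hG : G.Reachable p n₀ T) (h : G.stepProb γ α p q s ≠ 0) : p (G.wGroup s) ≠ 0 := by
  have hf := feasible_of_stepProb_ne_zero h
  cases s with
  | vertexStep k u =>
    intro hk
    apply h
    have hk' : p k = 0 := hk
    simp [stepProb, hk']
  | edgeStep w u => exact hG.group_ne_zero w hf.1

lemma Reachable.add {γ α q : ℝ} {p : Fin K → ℝ} {n₀ T : ℕ} {G : Network K} {s : Step K}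
    (hG : G.Reachable p n₀ T) (h : G.stepProb γ α p q s ≠ 0) :
    (G.add s).Reachable p n₀ (T + 1) := by
  have hf := feasible_of_stepProb_ne_zero h
  have hw := hG.wGroup_ne_zero h
  refine ⟨?_, ?_, ?_, ?_, ?_⟩
  · intro i hi
    rw [degree_add]
    cases s with
    | vertexStep k u =>
      have hu : u < G.numNodes := hf
      have hi' : G.numNodes + 1 ≤ i := hi
      rw [hG.degree_eq_zero i (by omega), wNode_vertexStep, uNode_vertexStep, if_neg (by omega), if_neg (by omega)]
    | edgeStep w u =>
      obtain ⟨hw, hu⟩ : w < G.numNodes ∧ u < G.numNodes := hf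
      have hi' : G.numNodes ≤ i := hi
      rw [hG.degree_eq_zero i hi', wNode_edgeStep, uNode_edgeStep, if_neg (by omega), if_neg (by omega)]
  · rw [totalDegree_eq_labelDegree, labelDegree_add G _ hf hG.degree_eq_zero,
      ← totalDegree_eq_labelDegree, hG.totalDegree_eq]
    simp only [if_true]
    ring
  · intro i hi
    cases s with
    | vertexStep k u =>
      have hi' : i < G.numNodes + 1 := hi
      by_cases hin : i = G.numNodes
      · subst hin
        simpa [Network.add, wGroup] using hw
      · simpa [Network.add, Function.update_of_ne hin] using hG.group_ne_zero i (by omega)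
    | edgeStep w u => exact hG.group_ne_zero i hi
  · intro k hk
    rw [groupDegree_eq_labelDegree, labelDegree_add G _ hf hG.degree_eq_zero]
    exact Nat.add_pos_left (hG.groupDegree_pos k hk) _
  · intro k
    rw [otherDegree_eq_labelDegree, labelDegree_add G _ hf hG.degree_eq_zero,
      ← otherDegree_eq_labelDegree]
    exact Nat.add_pos_left (hG.otherDegree_pos k) _

/-- Group k has initial degree share p_k, so p_k < 1 leaves degree outside it and p_k ≠ 0 puts
degree inside. A group with p_k = 0 is empty, and `group_ne_zero` keeps it so. -/
lemma reachable_initial {p : Fin K → ℝ} (hp_nonneg : ∀ k, 0 ≤ p k) (hp_lt : ∀ k, p k < 1)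
    {n₀ : ℕ} (hn₀ : 0 < n₀) {g₀ : ℕ → Fin K}
    (hg₀ : ∀ k, (((Finset.range n₀).filter fun i => g₀ i = k).card : ℝ) = p k * (n₀ : ℝ)) :
    (initial n₀ g₀).Reachable p n₀ 0 := by
  have hdeg : ∀ i, (initial n₀ g₀).degree i = if i < n₀ then 1 else 0 := by
    intro i
    rfl
  have hn : (0 : ℝ) < n₀ := by exact_mod_cast hn₀
  have hgd : ∀ k, (initial n₀ g₀).groupDegree k =
      ((Finset.range n₀).filter fun i => g₀ i = k).card := by
    intro k
    rw [Finset.card_filter]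
    refine Finset.sum_congr rfl fun i hi => ?_
    rw [hdeg, if_pos (Finset.mem_range.1 hi)]
    rfl
  have htot : (initial n₀ g₀).totalDegree = n₀ := by
    unfold totalDegree
    rw [Finset.sum_congr rfl (g := fun _ => 1) (fun i hi => by
      rw [hdeg]; exact if_pos (Finset.mem_range.1 hi))]
    simp [initial]
  refine ⟨?_, ?_, ?_, ?_, ?_⟩
  · intro i hi
    have : n₀ ≤ i := hi
    rw [hdeg, if_neg (by omega)]
  · rw [htot]; ring
  · intro i hi h0
    have := hg₀ (g₀ i)
    have h0' : p (g₀ i) = 0 := h0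
    rw [h0', zero_mul, Nat.cast_eq_zero, Finset.card_eq_zero] at this
    have hm : i ∈ (Finset.range n₀).filter fun j => g₀ j = g₀ i :=
      Finset.mem_filter.2 ⟨Finset.mem_range.2 hi, rfl⟩
    rw [this] at hm
    simp at hm
  · intro k hk
    have h1 : (0 : ℝ) < ((initial n₀ g₀).groupDegree k : ℝ) := by
      rw [hgd, hg₀]
      exact mul_pos (lt_of_le_of_ne (hp_nonneg k) (Ne.symm hk)) hn
    exact_mod_cast h1
  · intro k
    have h1 : ((initial n₀ g₀).groupDegree k : ℝ) < n₀ := by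
      rw [hgd, hg₀]
      nlinarith [hp_lt k]
    have h2 : (initial n₀ g₀).groupDegree k < n₀ := by exact_mod_cast h1
    have := groupDegree_add_otherDegree (initial n₀ g₀) k
    omega

/-- The fraction of the total degree that lies outside group `k`. -/
noncomputable def otherShare (G : Network K) (k : Fin K) : ℝ :=
  (G.otherDegree k : ℝ) / (G.totalDegree : ℝ)

lemma otherShare_nonneg (G : Network K) (k : Fin K) : 0 ≤ G.otherShare k := by
  unfold otherShare; positivity

lemma otherShare_le_one (G : Network K) (k : Fin K) : G.otherShare k ≤ 1 := by
  unfold otherShare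
  apply div_le_one_of_le₀ _ (Nat.cast_nonneg _)
  have := groupDegree_add_otherDegree G k
  exact_mod_cast (by omega : G.otherDegree k ≤ G.totalDegree)

lemma sum_degree_mul_ite (G : Network K) (k : Fin K) (a b : ℝ) :
    ∑ u ∈ Finset.range G.numNodes, (G.degree u : ℝ) * (if G.group u = k then a else b) =
      G.groupDegree k * a + G.otherDegree k * b := by
  unfold groupDegree otherDegree
  push_cast
  rw [Finset.sum_mul, Finset.sum_mul, ← Finset.sum_add_distrib]
  refine Finset.sum_congr rfl fun i _ => ?_
  split_ifs <;> simp

/-! ### Closed form of the connection probabilities -/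

section Connect

variable {γ α : ℝ}

lemma firstReject_eq (G : Network K) (k : Fin K) :
    G.firstReject γ k = (1 - γ) * G.otherShare k := by
  have : G.firstReject γ k = ∑ u ∈ Finset.range G.numNodes,
      (G.degree u : ℝ) * (if G.group u = k then 0 else (1 - γ) / G.totalDegree) := by
    refine Finset.sum_congr rfl fun u _ => ?_
    unfold prefProb accept
    split_ifs <;> ring
  rw [this, sum_degree_mul_ite, otherShare]
  ring

lemma laterReject_eq {G : Network K} {k : Fin K} (hO : 0 < G.otherDegree k) :
    G.laterReject γ α k = (1 - α) * (1 - γ) := by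
  have : G.laterReject γ α k = ∑ u ∈ Finset.range G.numNodes,
      (G.degree u : ℝ) * (if G.group u = k then 0 else (1 - α) * (1 - γ) / G.otherDegree k) := by
    refine Finset.sum_congr rfl fun u _ => ?_
    unfold reproposeProb accept
    split_ifs <;> ring
  have hO' : (G.otherDegree k : ℝ) ≠ 0 := by exact_mod_cast hO.ne'
  rw [this, sum_degree_mul_ite]
  field_simp
  ring

/-- Each later proposal is rejected with the same probability (1 - α)(1 - γ), so the series is
geometric with sum 1 / (γ + α(1 - γ)). The shape "degree times a same-group alternative" is the one
that `sum_degree_mul_ite` sums. -/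
lemma connectProb_eq (hγ : γ ∈ Set.Ioc (0 : ℝ) 1) (hα : α ∈ Set.Ioc (0 : ℝ) 1) {G : Network K}
    {k : Fin K} (hO : 0 < G.otherDegree k) (u : ℕ) :
    G.connectProb γ α k u = (G.degree u : ℝ) * (if G.group u = k then
      1 / G.totalDegree + (1 - γ) * G.otherShare k / (γ + α * (1 - γ)) * (α / G.groupDegree k)
      else γ * (1 / G.totalDegree +
        (1 - γ) * G.otherShare k / (γ + α * (1 - γ)) * ((1 - α) / G.otherDegree k))) := by
  obtain ⟨hγ0, hγ1⟩ := hγ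
  obtain ⟨hα0, hα1⟩ := hα
  have h0 : 0 ≤ (1 - α) * (1 - γ) := mul_nonneg (by linarith) (by linarith)
  have h1 : (1 - α) * (1 - γ) < 1 := by nlinarith
  unfold connectProb
  rw [laterReject_eq hO, firstReject_eq, tsum_mul_right, tsum_mul_left,
    tsum_geometric_of_lt_one h0 h1]
  have e : 1 - (1 - α) * (1 - γ) = γ + α * (1 - γ) := by ring
  rw [e]
  unfold prefProb accept reproposeProb
  split_ifs <;> ring

lemma connectProb_nonneg (hγ : γ ∈ Set.Ioc (0 : ℝ) 1) (hα : α ∈ Set.Ioc (0 : ℝ) 1) {G : Network K}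
    {k : Fin K} (hO : 0 < G.otherDegree k) (u : ℕ) : 0 ≤ G.connectProb γ α k u := by
  rw [connectProb_eq hγ hα hO]
  have h1 : 0 ≤ 1 - γ := by linarith [hγ.2]
  have h2 : 0 ≤ 1 - α := by linarith [hα.2]
  have h3 := hγ.1.le
  have h4 := hα.1.le
  have h5 := G.otherShare_nonneg k
  split_ifs <;> positivity

/-- The repeated proposals connect a node of group `k` to another group with probability
`θ* (1 - P^k)`. -/
lemma sum_connectProb_mul_ite (hγ : γ ∈ Set.Ioc (0 : ℝ) 1) (hα : α ∈ Set.Ioc (0 : ℝ) 1)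
    {G : Network K} {k : Fin K} (hD : 0 < G.groupDegree k) (hO : 0 < G.otherDegree k) (a b : ℝ) :
    ∑ u ∈ Finset.range G.numNodes, G.connectProb γ α k u * (if G.group u = k then a else b) =
      (1 - γ / (γ + α * (1 - γ)) * G.otherShare k) * a +
        γ / (γ + α * (1 - γ)) * G.otherShare k * b := by
  have hm : γ + α * (1 - γ) ≠ 0 := by
    have h1 : 0 ≤ 1 - γ := by linarith [hγ.2]
    have := mul_nonneg hα.1.le h1
    linarith [hγ.1]
  have hD' : (G.groupDegree k : ℝ) ≠ 0 := by exact_mod_cast hD.ne'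
  have hO' : (G.otherDegree k : ℝ) ≠ 0 := by exact_mod_cast hO.ne'
  have ht : (G.totalDegree : ℝ) = G.groupDegree k + G.otherDegree k := by
    exact_mod_cast (groupDegree_add_otherDegree G k).symm
  have ht' : (G.groupDegree k : ℝ) + G.otherDegree k ≠ 0 := by positivity
  have : ∀ u ∈ Finset.range G.numNodes,
      G.connectProb γ α k u * (if G.group u = k then a else b) =
      (G.degree u : ℝ) * (if G.group u = k then
      (1 / G.totalDegree + (1 - γ) * G.otherShare k / (γ + α * (1 - γ)) * (α / G.groupDegree k)) * a
      else γ * (1 / G.totalDegree +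
        (1 - γ) * G.otherShare k / (γ + α * (1 - γ)) * ((1 - α) / G.otherDegree k)) * b) := by
    intro u _
    rw [connectProb_eq hγ hα hO]
    split_ifs <;> ring
  rw [Finset.sum_congr rfl this, sum_degree_mul_ite]
  unfold otherShare
  rw [ht]
  -- With m opaque the denominators clear. The coefficient of `b` then rests on m + (1 - γ)(1 - α) =
  -- 1.
  set m := γ + α * (1 - γ) with hm_def
  field_simp
  rw [hm_def]
  ring

end Connect

/-! ### Conditional expectations of one step -/

/-- The expectation of a function of the next step. -/
noncomputable def stepMean (γ α : ℝ) (p : Fin K → ℝ) (q : ℝ) (G : Network K) (f : Step K → ℝ) :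
    ℝ :=
  ∑ k : Fin K, ∑ u ∈ Finset.range G.numNodes,
      G.stepProb γ α p q (.vertexStep k u) * f (.vertexStep k u) +
    ∑ w ∈ Finset.range G.numNodes, ∑ u ∈ Finset.range G.numNodes,
      G.stepProb γ α p q (.edgeStep w u) * f (.edgeStep w u)

section StepMean

variable {γ α q : ℝ} {p : Fin K → ℝ} {n₀ T : ℕ} {G : Network K}

lemma Reachable.stepProb_nonneg (hγ : γ ∈ Set.Ioc (0 : ℝ) 1) (hα : α ∈ Set.Ioc (0 : ℝ) 1)
    (hq : q ∈ Set.Ioc (0 : ℝ) 1) (hp : ∀ k, 0 ≤ p k) (hG : G.Reachable p n₀ T) (s : Step K) :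
    0 ≤ G.stepProb γ α p q s := by
  have hq1 : 0 ≤ 1 - q := by linarith [hq.2]
  cases s with
  | vertexStep k u =>
    unfold stepProb
    have := connectProb_nonneg hγ hα (hG.otherDegree_pos k) u
    have := hp k
    have := hq.1
    simp only
    split_ifs <;> positivity
  | edgeStep w u =>
    unfold stepProb
    have := connectProb_nonneg hγ hα (hG.otherDegree_pos (G.group w)) u
    simp only [prefProb]
    split_ifs <;> positivity

lemma Reachable.stepMean_mono (hγ : γ ∈ Set.Ioc (0 : ℝ) 1) (hα : α ∈ Set.Ioc (0 : ℝ) 1)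
    (hq : q ∈ Set.Ioc (0 : ℝ) 1) (hp : ∀ k, 0 ≤ p k) (hG : G.Reachable p n₀ T)
    {f g : Step K → ℝ} (hfg : ∀ s, f s ≤ g s) :
    G.stepMean γ α p q f ≤ G.stepMean γ α p q g := by
  unfold stepMean
  gcongr <;> first | exact hG.stepProb_nonneg hγ hα hq hp _ | exact hfg _

lemma stepMean_add_mul (f : Step K → ℝ) (a b : ℝ) :
    G.stepMean γ α p q (fun s => a + b * f s) =
      a * G.stepMean γ α p q (fun _ => 1) + b * G.stepMean γ α p q f := by
  unfold stepMean
  simp only [mul_add, Finset.mul_sum, Finset.sum_add_distrib]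
  have h : ∀ x y : ℝ, x * (b * y) = b * (x * y) := fun x y => by ring
  have h2 : ∀ x : ℝ, x * a = a * (x * 1) := fun x => by ring
  simp only [h, h2]
  ring

lemma Reachable.sum_prefProb (hG : G.Reachable p n₀ T) (hT : 0 < 2 * T + n₀) :
    ∑ w ∈ Finset.range G.numNodes, G.prefProb w = 1 := by
  unfold prefProb
  rw [← Finset.sum_div, ← Nat.cast_sum]
  refine div_self ?_
  change ((G.totalDegree : ℕ) : ℝ) ≠ 0
  rw [hG.totalDegree_eq]
  exact_mod_cast hT.ne'

/-- The expectation of a function of the kind of the next step, of the group of the first endpoint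
and of whether both endpoints have the same group. -/
lemma Reachable.stepMean_eq (hγ : γ ∈ Set.Ioc (0 : ℝ) 1) (hα : α ∈ Set.Ioc (0 : ℝ) 1)
    (hG : G.Reachable p n₀ T) {f : Step K → ℝ} {φ : Bool → Fin K → ℝ} {χ : Bool → Fin K → ℝ}
    (hf : ∀ s, f s = if G.uGroup s = G.wGroup s then φ s.isVertex (G.wGroup s)
      else χ s.isVertex (G.wGroup s)) :
    G.stepMean γ α p q f =
      q * ∑ k, p k * ((1 - γ / (γ + α * (1 - γ)) * G.otherShare k) * φ true k +
        γ / (γ + α * (1 - γ)) * G.otherShare k * χ true k) +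
      (1 - q) * ∑ w ∈ Finset.range G.numNodes, G.prefProb w *
        ((1 - γ / (γ + α * (1 - γ)) * G.otherShare (G.group w)) * φ false (G.group w) +
        γ / (γ + α * (1 - γ)) * G.otherShare (G.group w) * χ false (G.group w)) := by
  unfold stepMean
  rw [Finset.mul_sum, Finset.mul_sum]
  congr 1
  · refine Finset.sum_congr rfl fun k _ => ?_
    -- Such a group may have degree zero, where the closed form fails, but then its arrivals have no
    -- mass.
    by_cases hk : p k = 0
    · simp [stepProb, hk]
    rw [← sum_connectProb_mul_ite hγ hα (hG.groupDegree_pos k hk) (hG.otherDegree_pos k),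
      Finset.mul_sum, Finset.mul_sum]
    refine Finset.sum_congr rfl fun u hu => ?_
    rw [hf]
    rw [uGroup_vertexStep, wGroup_vertexStep]
    simp only [stepProb, if_pos (Finset.mem_range.1 hu), Step.isVertex]
    ring
  · refine Finset.sum_congr rfl fun w hw => ?_
    have hw' := Finset.mem_range.1 hw
    rw [← sum_connectProb_mul_ite hγ hα (hG.groupDegree_pos _ (hG.group_ne_zero w hw'))
      (hG.otherDegree_pos _), Finset.mul_sum, Finset.mul_sum]
    refine Finset.sum_congr rfl fun u hu => ?_
    rw [hf]
    rw [uGroup_edgeStep, wGroup_edgeStep]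
    simp only [stepProb, hw', Finset.mem_range.1 hu, and_self, if_true, Step.isVertex]
    ring

/-- The expectation of a function of the kind of the next step and of the group of the first
endpoint. -/
lemma Reachable.stepMean_eq_of_wGroup (hγ : γ ∈ Set.Ioc (0 : ℝ) 1) (hα : α ∈ Set.Ioc (0 : ℝ) 1)
    (hG : G.Reachable p n₀ T) {f : Step K → ℝ} {φ : Bool → Fin K → ℝ}
    (hf : ∀ s, f s = φ s.isVertex (G.wGroup s)) :
    G.stepMean γ α p q f = q * ∑ k, p k * φ true k +
      (1 - q) * ∑ w ∈ Finset.range G.numNodes, G.prefProb w * φ false (G.group w) := by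
  rw [hG.stepMean_eq hγ hα (φ := φ) (χ := φ) (fun s => by rw [hf, ite_self])]
  simp only [← add_mul, sub_add_cancel, one_mul]

lemma Reachable.stepMean_one (hγ : γ ∈ Set.Ioc (0 : ℝ) 1) (hα : α ∈ Set.Ioc (0 : ℝ) 1)
    (hp_sum : ∑ k, p k = 1) (hG : G.Reachable p n₀ T) (hT : 0 < 2 * T + n₀) :
    G.stepMean γ α p q (fun _ => 1) = 1 := by
  rw [hG.stepMean_eq_of_wGroup hγ hα (φ := fun _ _ => 1) (fun _ => rfl)]
  simp only [mul_one, hp_sum, hG.sum_prefProb hT]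
  ring

end StepMean

end Network

end KPA

/-! ### Histories as finite lists of steps -/

namespace KPA

variable {K : ℕ}

/-- The two kinds of steps as a sum type. -/
def Step.equivSum : Step K ≃ (Fin K × ℕ) ⊕ (ℕ × ℕ) where
  toFun
    | .vertexStep k u => Sum.inl (k, u)
    | .edgeStep w u => Sum.inr (w, u)
  invFun
    | Sum.inl x => .vertexStep x.1 x.2
    | Sum.inr x => .edgeStep x.1 x.2
  left_inv s := by cases s <;> rfl
  right_inv x := by rcases x with x | x <;> rfl

instance : Countable (Step K) := Step.equivSum.injective.countable

/-- The graph obtained from `G₀` by a list of steps, the latest step first. -/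
def Network.replay (G₀ : Network K) : List (Step K) → Network K
  | [] => G₀
  | s :: l => (G₀.replay l).add s

/-- The first `T` steps, the latest one first. -/
def history (s : ℕ → Step K) : ℕ → List (Step K)
  | 0 => []
  | T + 1 => s T :: history s T

lemma replay_history (G₀ : Network K) (s : ℕ → Step K) (T : ℕ) :
    G₀.replay (history s T) = G₀.run s T := by
  induction T with
  | zero => rfl
  | succ T ih => rw [history, Network.replay, ih, Network.run]

lemma length_history (s : ℕ → Step K) (T : ℕ) : (history s T).length = T := by
  induction T with
  | zero => rfl
  | succ T ih => rw [history, List.length_cons, ih]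

lemma history_eq_iff (s s' : ℕ → Step K) (T : ℕ) :
    history s T = history s' T ↔ ∀ t < T, s t = s' t := by
  induction T with
  | zero => simp [history]
  | succ T ih =>
    rw [history, history, List.cons.injEq, ih]
    constructor
    · rintro ⟨h1, h2⟩ t ht
      rcases Nat.lt_succ_iff_lt_or_eq.1 ht with h | rfl
      exacts [h2 t h, h1]
    · intro h
      exact ⟨h T (Nat.lt_succ_self T), fun t ht => h t (by omega)⟩

/-- The model's `law` speaks of infinite step sequences; this carries it over to the countable set
of lists. -/
lemma exists_history_eq (l : List (Step K)) : ∃ s : ℕ → Step K, history s l.length = l := by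
  induction l with
  | nil => exact ⟨fun _ => .edgeStep 0 0, rfl⟩
  | cons a l ih =>
    obtain ⟨s, hs⟩ := ih
    refine ⟨Function.update s l.length a, ?_⟩
    rw [List.length_cons, history, Function.update_self]
    congr 1
    refine Eq.trans ((history_eq_iff _ _ _).2 fun t ht => ?_) hs
    exact Function.update_of_ne ht.ne _ _

/-- The sum of the values of a statistic along a list of steps. -/
noncomputable def statSum (G₀ : Network K) (f : Network K → Step K → ℝ) : List (Step K) → ℝ
  | [] => 0
  | s :: l => statSum G₀ f l + f (G₀.replay l) s

lemma statSum_history (G₀ : Network K) (f : Network K → Step K → ℝ) (s : ℕ → Step K) (T : ℕ) :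
    statSum G₀ f (history s T) = ∑ t ∈ Finset.range T, f (G₀.run s t) (s t) := by
  induction T with
  | zero => rfl
  | succ T ih => rw [history, statSum, ih, replay_history, Finset.sum_range_succ]

/-- Histories take countably many values, so expectations become sums over atoms and conditioning
becomes multiplication by `stepProb`. -/
lemma lintegral_comp_of_countable {Ω β : Type*} [MeasurableSpace Ω] [Countable β]
    (μ : Measure Ω) {X : Ω → β} (hX : ∀ b, MeasurableSet {ω | X ω = b}) (F : β → ENNReal) :
    ∫⁻ ω, F (X ω) ∂μ = ∑' b, F b * μ {ω | X ω = b} := by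
  let : MeasurableSpace β := ⊤
  have hm : Measurable X := measurable_to_countable' hX
  rw [← lintegral_map (μ := μ) (f := F) (g := X) (fun _ _ => trivial) hm, lintegral_countable']
  refine tsum_congr fun b => ?_
  rw [Measure.map_apply hm trivial]
  rfl

/-- Steps that use absent nodes have probability zero, so the series over all steps reduces to the
finite sums of `stepMean`. -/
lemma tsum_stepProb_mul {γ α q : ℝ} {p : Fin K → ℝ} {G : Network K} {F : Step K → ℝ}
    (hG : ∀ s, 0 ≤ G.stepProb γ α p q s) (hF : ∀ s, 0 ≤ F s) :
    ∑' s, ENNReal.ofReal (G.stepProb γ α p q s) * ENNReal.ofReal (F s) =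
      ENNReal.ofReal (G.stepMean γ α p q F) := by
  have hsum : ∀ h : ℕ → Step K, (∀ u, G.numNodes ≤ u → G.stepProb γ α p q (h u) = 0) →
      ∑' u, ENNReal.ofReal (G.stepProb γ α p q (h u)) * ENNReal.ofReal (F (h u)) =
        ENNReal.ofReal (∑ u ∈ Finset.range G.numNodes, G.stepProb γ α p q (h u) * F (h u)) := by
    intro h hh
    rw [tsum_eq_sum (s := Finset.range G.numNodes),
      ENNReal.ofReal_sum_of_nonneg (fun u _ => mul_nonneg (hG _) (hF _))]
    · exact Finset.sum_congr rfl fun u _ => (ENNReal.ofReal_mul (hG _)).symm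
    · intro u hu
      rw [hh u (by simpa using hu)]
      simp
  have hnn : ∀ h : ℕ → Step K,
      0 ≤ ∑ u ∈ Finset.range G.numNodes, G.stepProb γ α p q (h u) * F (h u) := fun h =>
    Finset.sum_nonneg fun u _ => mul_nonneg (hG _) (hF _)
  rw [← Step.equivSum.symm.tsum_eq, Summable.tsum_sum ENNReal.summable ENNReal.summable,
    ENNReal.tsum_prod', ENNReal.tsum_prod', Network.stepMean,
    ENNReal.ofReal_add (Finset.sum_nonneg fun k _ => hnn _) (Finset.sum_nonneg fun k _ => hnn _)]
  congr 1
  · rw [tsum_fintype, ENNReal.ofReal_sum_of_nonneg fun k _ => hnn _]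
    refine Finset.sum_congr rfl fun k _ => hsum (fun u => .vertexStep k u) fun u hu => ?_
    exact if_neg (by omega)
  · rw [tsum_eq_sum (s := Finset.range G.numNodes), ENNReal.ofReal_sum_of_nonneg fun k _ => hnn _]
    · refine Finset.sum_congr rfl fun w _ => hsum (fun u => .edgeStep w u) fun u hu => ?_
      exact if_neg (by omega)
    · intro w hw
      rw [ENNReal.tsum_eq_zero]
      intro u
      have : G.stepProb γ α p q (.edgeStep w u) = 0 := if_neg (by simp at hw; omega)
      change ENNReal.ofReal (G.stepProb γ α p q (.edgeStep w u)) * _ = 0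
      rw [this]
      simp

/-! ### Exponential moments and Borel–Cantelli -/

namespace IsKPAModel

variable {Ω : Type*} [MeasurableSpace Ω] {μ : Measure Ω} {G₀ : Network K} {γ α q : ℝ}
  {p : Fin K → ℝ} {ξ : ℕ → Ω → Step K}

lemma measurableSet_history (hξ : IsKPAModel μ G₀ γ α p q ξ) (T : ℕ) (l : List (Step K)) :
    MeasurableSet {ω | history (fun t => ξ t ω) T = l} := by
  induction T generalizing l with
  | zero => exact MeasurableSet.const ([] = l)
  | succ T ih =>
    cases l with
    | nil => simp [history]
    | cons a l =>
      simp only [history, List.cons.injEq]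
      exact (hξ.measurableSet_eq T a).inter (ih l)

lemma measurableSet_history_step (hξ : IsKPAModel μ G₀ γ α p q ξ) (T : ℕ)
    (x : List (Step K) × Step K) :
    MeasurableSet {ω | (history (fun t => ξ t ω) T, ξ T ω) = x} := by
  simp only [Prod.ext_iff]
  exact (hξ.measurableSet_history T x.1).inter (hξ.measurableSet_eq T x.2)

lemma measure_history_step [IsFiniteMeasure μ] (hξ : IsKPAModel μ G₀ γ α p q ξ) (T : ℕ)
    (l : List (Step K)) (a : Step K) :
    μ {ω | (history (fun t => ξ t ω) T, ξ T ω) = (l, a)} =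
      μ {ω | history (fun t => ξ t ω) T = l} *
        ENNReal.ofReal ((G₀.replay l).stepProb γ α p q a) := by
  by_cases hl : l.length = T
  · obtain ⟨s, hs⟩ := exists_history_eq l
    rw [hl] at hs
    let s' := Function.update s T a
    have hs' : history s' T = l := by
      rw [← hs, history_eq_iff]
      intro t ht
      exact Function.update_of_ne ht.ne _ _
    have hsT : s' T = a := Function.update_self _ _ _
    have h1 : {ω | (history (fun t => ξ t ω) T, ξ T ω) = (l, a)} =
        {ω | ∀ t < T + 1, ξ t ω = s' t} := by
      ext ω
      have := history_eq_iff (fun t => ξ t ω) s' (T + 1)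
      rw [history, history, hs', hsT, List.cons.injEq] at this
      rw [Set.mem_ofPred_eq, Set.mem_ofPred_eq, ← this, Prod.mk.injEq, and_comm]
    have h2 : {ω | history (fun t => ξ t ω) T = l} = {ω | ∀ t < T, ξ t ω = s' t} := by
      ext ω
      rw [Set.mem_ofPred_eq, Set.mem_ofPred_eq, ← history_eq_iff, hs']
    have h3 := hξ.law T s'
    rw [← replay_history, hs', hsT] at h3
    rw [h1, h2, ← ofReal_measureReal, ← ofReal_measureReal, h3,
      ENNReal.ofReal_mul measureReal_nonneg]
  · have h0 : {ω | history (fun t => ξ t ω) T = l} = ∅ := by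
      ext ω
      simp only [Set.mem_ofPred_eq, Set.mem_empty_iff_false, iff_false]
      intro h
      exact hl (by rw [← h, length_history])
    have h1 : {ω | (history (fun t => ξ t ω) T, ξ T ω) = (l, a)} = ∅ := by
      rw [← Set.subset_empty_iff, ← h0]
      exact fun ω hω => (Prod.mk.inj hω).1
    rw [h0, h1]
    simp

/-- There are only countably many pairs of a history and a next step, and each pair with vanishing
step probability is a null event. -/
lemma ae_stepProb_ne_zero [IsFiniteMeasure μ] (hξ : IsKPAModel μ G₀ γ α p q ξ) :
    ∀ᵐ ω ∂μ, ∀ T, (G₀.run (fun t => ξ t ω) T).stepProb γ α p q (ξ T ω) ≠ 0 := by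
  rw [ae_all_iff]
  intro T
  have h : ∀ᵐ ω ∂μ, ∀ x : List (Step K) × Step K, (G₀.replay x.1).stepProb γ α p q x.2 = 0 →
      (history (fun t => ξ t ω) T, ξ T ω) ≠ x := by
    rw [ae_all_iff]
    rintro ⟨l, a⟩
    by_cases h0 : (G₀.replay l).stepProb γ α p q a = 0
    · have := hξ.measure_history_step T l a
      rw [h0, ENNReal.ofReal_zero, mul_zero] at this
      filter_upwards [measure_eq_zero_iff_ae_notMem.1 this] with ω hω _
      exact hω
    · exact Eventually.of_forall fun ω h1 => absurd h1 h0
  filter_upwards [h] with ω hω h0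
  rw [← replay_history] at h0
  exact hω _ h0 rfl

lemma ae_reachable [IsFiniteMeasure μ] (hξ : IsKPAModel μ G₀ γ α p q ξ) {n₀ : ℕ}
    (hG₀ : G₀.Reachable p n₀ 0) :
    ∀ᵐ ω ∂μ, ∀ T, (G₀.run (fun t => ξ t ω) T).Reachable p n₀ T := by
  filter_upwards [hξ.ae_stepProb_ne_zero] with ω hω T
  induction T with
  | zero => exact hG₀
  | succ T ih => exact ih.add (hω T)

/-- An atom of positive mass meets every almost sure event, and the graph is determined by the atom.
-/
lemma reachable_replay [IsFiniteMeasure μ] (hξ : IsKPAModel μ G₀ γ α p q ξ) {n₀ : ℕ}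
    (hG₀ : G₀.Reachable p n₀ 0) {T : ℕ} {l : List (Step K)}
    (hl : μ {ω | history (fun t => ξ t ω) T = l} ≠ 0) : (G₀.replay l).Reachable p n₀ T := by
  obtain ⟨ω, h1, h2⟩ :=
    ((frequently_ae_mem_iff.2 hl).and_eventually (hξ.ae_reachable hG₀)).exists
  have h1 : history (fun t => ξ t ω) T = l := h1
  have := h2 T
  rwa [← replay_history, h1] at this

/-- The exponential moments of a statistic grow at most geometrically if its conditional exponential
moments are bounded. -/
lemma lintegral_exp_statSum_le [IsProbabilityMeasure μ] (hξ : IsKPAModel μ G₀ γ α p q ξ)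
    (hγ : γ ∈ Set.Ioc (0 : ℝ) 1) (hα : α ∈ Set.Ioc (0 : ℝ) 1) (hq : q ∈ Set.Ioc (0 : ℝ) 1)
    (hp : ∀ k, 0 ≤ p k) {n₀ : ℕ} (hG₀ : G₀.Reachable p n₀ 0) {f : Network K → Step K → ℝ}
    {c ρ : ℝ} (hf : ∀ (T : ℕ) (G : Network K), G.Reachable p n₀ T →
      G.stepMean γ α p q (fun s => Real.exp (c * f G s)) ≤ ρ) (T : ℕ) :
    ∫⁻ ω, ENNReal.ofReal (Real.exp (c * statSum G₀ f (history (fun t => ξ t ω) T))) ∂μ ≤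
      ENNReal.ofReal ρ ^ T := by
  induction T with
  | zero => simp [history, statSum]
  | succ T ih =>
    have h1 := lintegral_comp_of_countable μ (hξ.measurableSet_history_step T)
      (fun x => ENNReal.ofReal (Real.exp (c * statSum G₀ f (x.2 :: x.1))))
    simp only [history]
    rw [h1, ENNReal.tsum_prod']
    rw [lintegral_comp_of_countable μ (hξ.measurableSet_history T)
      (fun l => ENNReal.ofReal (Real.exp (c * statSum G₀ f l)))] at ih
    rw [pow_succ]
    refine le_trans ?_ (mul_le_mul_left ih _)
    rw [← ENNReal.tsum_mul_right]
    refine ENNReal.tsum_le_tsum fun l => ?_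
    -- `hf` covers reachable graphs only, so histories of zero mass are discarded here.
    by_cases hl : μ {ω | history (fun t => ξ t ω) T = l} = 0
    · have h0 : ∀ a, μ {ω | (history (fun t => ξ t ω) T, ξ T ω) = (l, a)} = 0 := fun a => by
        rw [hξ.measure_history_step, hl, zero_mul]
      simp only [h0, mul_zero, tsum_zero]
      exact zero_le
    have hR := hξ.reachable_replay hG₀ hl
    have h2 : ∀ a, ENNReal.ofReal (Real.exp (c * statSum G₀ f (a :: l))) *
        μ {ω | (history (fun t => ξ t ω) T, ξ T ω) = (l, a)} =
        ENNReal.ofReal (Real.exp (c * statSum G₀ f l)) *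
        μ {ω | history (fun t => ξ t ω) T = l} *
        (ENNReal.ofReal ((G₀.replay l).stepProb γ α p q a) *
          ENNReal.ofReal (Real.exp (c * f (G₀.replay l) a))) := by
      intro a
      rw [hξ.measure_history_step, statSum, mul_add, Real.exp_add,
        ENNReal.ofReal_mul (Real.exp_pos _).le]
      ring
    rw [tsum_congr h2, ENNReal.tsum_mul_left, tsum_stepProb_mul
      (hR.stepProb_nonneg hγ hα hq hp) (fun _ => (Real.exp_pos _).le)]
    gcongr
    exact hf T _ hR

/-- A bounded statistic with uniformly negative drift has eventually negative sums. -/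
lemma ae_eventually_sum_neg [IsProbabilityMeasure μ] (hξ : IsKPAModel μ G₀ γ α p q ξ)
    (hγ : γ ∈ Set.Ioc (0 : ℝ) 1) (hα : α ∈ Set.Ioc (0 : ℝ) 1) (hq : q ∈ Set.Ioc (0 : ℝ) 1)
    (hp : ∀ k, 0 ≤ p k) (hp_sum : ∑ k, p k = 1) {n₀ : ℕ} (hn₀ : 0 < n₀)
    (hG₀ : G₀.Reachable p n₀ 0) (f : Network K → Step K → ℝ)
    {C δ : ℝ} (hC : 0 < C) (hfC : ∀ G s, |f G s| ≤ C) (hδ : 0 < δ)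
    (hf : ∀ (T : ℕ) (G : Network K), G.Reachable p n₀ T → G.stepMean γ α p q (f G) ≤ -δ) :
    ∀ᵐ ω ∂μ, ∀ᶠ T in atTop,
      ∑ t ∈ Finset.range T, f (G₀.run (fun i => ξ i ω) t) (ξ t ω) < 0 := by
  -- The first bound on c permits e^y ≤ 1 + y + y² at y = c f; the second lets the quadratic term
  -- consume at most half of the drift: 1 - cδ + c²C² ≤ 1 - cδ/2.
  obtain ⟨c, hc0, hc1, hc2⟩ : ∃ c : ℝ, 0 < c ∧ c * C ≤ 1 ∧ c * C ^ 2 ≤ δ / 2 := by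
    refine ⟨min (1 / C) (δ / (2 * C ^ 2)), by positivity, ?_, ?_⟩
    · calc _ ≤ 1 / C * C := by gcongr; exact min_le_left _ _
        _ = 1 := by field_simp
    · calc _ ≤ δ / (2 * C ^ 2) * C ^ 2 := by gcongr; exact min_le_right _ _
        _ = δ / 2 := by field_simp
  have hρ : ∀ (T : ℕ) (G : Network K), G.Reachable p n₀ T →
      G.stepMean γ α p q (fun s => Real.exp (c * f G s)) ≤ 1 - c * (δ / 2) := by
    intro T G hG
    have h1 : ∀ s, Real.exp (c * f G s) ≤ (1 + c ^ 2 * C ^ 2) + c * f G s := by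
      intro s
      have ha : |c * f G s| ≤ c * C := by
        rw [abs_mul, abs_of_pos hc0]
        exact mul_le_mul_of_nonneg_left (hfC G s) hc0.le
      have h2 := (abs_le.1 (Real.abs_exp_sub_one_sub_id_le (ha.trans hc1))).2
      have h3 : (c * f G s) ^ 2 ≤ (c * C) ^ 2 := sq_le_sq' (abs_le.1 ha).1 (abs_le.1 ha).2
      nlinarith
    have h2 := hG.stepMean_mono hγ hα hq hp h1
    rw [Network.stepMean_add_mul, hG.stepMean_one hγ hα hp_sum (by omega)] at h2
    have h3 := mul_le_mul_of_nonneg_left (hf T G hG) hc0.le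
    have h4 := mul_le_mul_of_nonneg_left hc2 hc0.le
    nlinarith
  have hint := hξ.lintegral_exp_statSum_le hγ hα hq hp hG₀ hρ
  have hρ1 : ENNReal.ofReal (1 - c * (δ / 2)) < 1 := by
    rw [ENNReal.ofReal_lt_one]
    have : 0 < c * (δ / 2) := by positivity
    linarith
  -- The sum is nonnegative exactly on this event, whose probability is geometrically small by
  -- Markov's inequality.
  let A : ℕ → Set Ω := fun T => {ω | (1 : ENNReal) ≤
    ENNReal.ofReal (Real.exp (c * statSum G₀ f (history (fun t => ξ t ω) T)))}
  have hA : ∀ T, μ (A T) ≤ ENNReal.ofReal (1 - c * (δ / 2)) ^ T := by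
    intro T
    refine le_trans ?_ (hint T)
    have hm : Measurable fun ω =>
        ENNReal.ofReal (Real.exp (c * statSum G₀ f (history (fun t => ξ t ω) T))) := by
      let : MeasurableSpace (List (Step K)) := ⊤
      have h1 : Measurable fun ω => history (fun t => ξ t ω) T :=
        measurable_to_countable' (hξ.measurableSet_history T)
      exact Measurable.comp (g := fun l : List (Step K) =>
        ENNReal.ofReal (Real.exp (c * statSum G₀ f l))) (fun _ _ => trivial) h1
    have := mul_meas_ge_le_lintegral (μ := μ) hm 1
    rwa [one_mul] at this
  have hsum : ∑' T, μ (A T) ≠ ⊤ := by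
    refine ne_top_of_le_ne_top ?_ (ENNReal.tsum_le_tsum hA)
    rw [ENNReal.tsum_geometric]
    exact ENNReal.inv_ne_top.2 (tsub_pos_of_lt hρ1).ne'
  filter_upwards [ae_eventually_notMem hsum] with ω hω
  filter_upwards [hω] with T hT
  rw [← statSum_history]
  by_contra hneg
  apply hT
  change (1 : ENNReal) ≤ _
  rw [ENNReal.one_le_ofReal]
  exact Real.one_le_exp (mul_nonneg hc0.le (not_lt.1 hneg))

end IsKPAModel

end KPA

/-! ### Concavity of the log-likelihood in θ -/

namespace KPA

variable {K : ℕ}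

/-- The contribution of a step to the logarithm of the likelihood of `θ`, up to a constant. -/
noncomputable def logStat (θ : ℝ) (G : Network K) (s : Step K) : ℝ :=
  if G.uGroup s = G.wGroup s then Real.log (1 - θ * G.otherShare (G.wGroup s)) else Real.log θ

/-- The derivative of `logStat` with respect to `θ`. -/
noncomputable def scoreStat (θ : ℝ) (G : Network K) (s : Step K) : ℝ :=
  if G.uGroup s = G.wGroup s then
    -(G.otherShare (G.wGroup s) / (1 - θ * G.otherShare (G.wGroup s)))
  else 1 / θ

lemma log_le_log_add_div {a b : ℝ} (ha : 0 < a) (hb : 0 < b) :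
    Real.log b ≤ Real.log a + (b - a) / a := by
  have := Real.log_le_sub_one_of_pos (div_pos hb ha)
  rw [Real.log_div hb.ne' ha.ne'] at this
  rw [sub_div, div_self ha.ne']
  linarith

lemma log_lt_log_add_div {a b : ℝ} (ha : 0 < a) (hb : 0 < b) (hab : b ≠ a) :
    Real.log b < Real.log a + (b - a) / a := by
  have := Real.log_lt_sub_one_of_pos (div_pos hb ha) (fun h => hab ((div_eq_one_iff_eq ha.ne').1 h))
  rw [Real.log_div hb.ne' ha.ne'] at this
  rw [sub_div, div_self ha.ne']
  linarith

lemma one_sub_mul_pos {θ x : ℝ} (hθ : θ ∈ Set.Ioc (0 : ℝ) 1) (hx : x < 1) :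
    0 < 1 - θ * x := by
  nlinarith [hθ.1, hθ.2]

/-- Concavity in tangent-line form: θ and 1 - θx are affine in θ, so the tangent bound for the
logarithm transfers without differentiating. -/
lemma logStat_le {θ θ' : ℝ} (hθ : θ ∈ Set.Ioc (0 : ℝ) 1) (hθ' : θ' ∈ Set.Ioc (0 : ℝ) 1)
    {G : Network K} {s : Step K} (hx : G.otherShare (G.wGroup s) < 1) :
    logStat θ' G s ≤ logStat θ G s + scoreStat θ G s * (θ' - θ) := by
  unfold logStat scoreStat
  split_ifs
  · refine (log_le_log_add_div (one_sub_mul_pos hθ hx) (one_sub_mul_pos hθ' hx)).trans_eq ?_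
    ring
  · refine (log_le_log_add_div hθ.1 hθ'.1).trans_eq ?_
    ring

lemma logStat_lt {θ θ' : ℝ} (hθ : θ ∈ Set.Ioc (0 : ℝ) 1) (hθ' : θ' ∈ Set.Ioc (0 : ℝ) 1)
    (hne : θ' ≠ θ) {G : Network K} {s : Step K} (hs : G.uGroup s ≠ G.wGroup s) :
    logStat θ' G s < logStat θ G s + scoreStat θ G s * (θ' - θ) := by
  unfold logStat scoreStat
  rw [if_neg hs, if_neg hs, if_neg hs]
  refine (log_lt_log_add_div hθ.1 hθ'.1 hne).trans_eq ?_
  ring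

section Maximiser

variable {G : ℕ → Network K} {s : ℕ → Step K} {T : ℕ}

lemma sum_logStat_le (hx : ∀ t, (G t).otherShare ((G t).wGroup (s t)) < 1) {θ θ' : ℝ}
    (hθ : θ ∈ Set.Ioc (0 : ℝ) 1) (hθ' : θ' ∈ Set.Ioc (0 : ℝ) 1) :
    ∑ t ∈ Finset.range T, logStat θ' (G t) (s t) ≤ ∑ t ∈ Finset.range T, logStat θ (G t) (s t) +
      (∑ t ∈ Finset.range T, scoreStat θ (G t) (s t)) * (θ' - θ) := by
  rw [Finset.sum_mul, ← Finset.sum_add_distrib]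
  exact Finset.sum_le_sum fun t _ => logStat_le hθ hθ' (hx t)

/-- Edges within a group contribute nonpositive scores, so a positive total needs an edge between
groups. -/
lemma exists_uGroup_ne_wGroup (hx : ∀ t, (G t).otherShare ((G t).wGroup (s t)) < 1) {θ : ℝ}
    (hθ : θ ∈ Set.Ioc (0 : ℝ) 1) (hS : 0 < ∑ t ∈ Finset.range T, scoreStat θ (G t) (s t)) :
    ∃ t ∈ Finset.range T, (G t).uGroup (s t) ≠ (G t).wGroup (s t) := by
  by_contra! h
  refine absurd hS (not_lt.2 (Finset.sum_nonpos fun t ht => ?_))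
  rw [scoreStat, if_pos (h t ht)]
  exact neg_nonpos.2 (div_nonneg (Network.otherShare_nonneg _ _)
    (one_sub_mul_pos hθ (hx t)).le)

lemma sum_logStat_lt (hx : ∀ t, (G t).otherShare ((G t).wGroup (s t)) < 1) {θ θ' : ℝ}
    (hθ : θ ∈ Set.Ioc (0 : ℝ) 1) (hθ' : θ' ∈ Set.Ioc (0 : ℝ) 1) (hne : θ' ≠ θ)
    (hd : ∃ t ∈ Finset.range T, (G t).uGroup (s t) ≠ (G t).wGroup (s t)) :
    ∑ t ∈ Finset.range T, logStat θ' (G t) (s t) < ∑ t ∈ Finset.range T, logStat θ (G t) (s t) +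
      (∑ t ∈ Finset.range T, scoreStat θ (G t) (s t)) * (θ' - θ) := by
  rw [Finset.sum_mul, ← Finset.sum_add_distrib]
  obtain ⟨t, ht, h⟩ := hd
  exact Finset.sum_lt_sum (fun t _ => logStat_le hθ hθ' (hx t)) ⟨t, ht, logStat_lt hθ hθ' hne h⟩

/-- The interval (0, 1] is not compact, but a positive score at θ₁ makes every smaller parameter
worse than θ₁, so maximising over [θ₁, 1] suffices. -/
lemma exists_isMaxOn_sum_logStat (hx : ∀ t, (G t).otherShare ((G t).wGroup (s t)) < 1) {θ₁ : ℝ}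
    (hθ₁ : θ₁ ∈ Set.Ioc (0 : ℝ) 1) (hS : 0 < ∑ t ∈ Finset.range T, scoreStat θ₁ (G t) (s t)) :
    ∃ θ ∈ Set.Ioc (0 : ℝ) 1, ∀ θ' ∈ Set.Ioc (0 : ℝ) 1,
      ∑ t ∈ Finset.range T, logStat θ' (G t) (s t) ≤
        ∑ t ∈ Finset.range T, logStat θ (G t) (s t) := by
  have hsub : ∀ θ ∈ Set.Icc θ₁ 1, θ ∈ Set.Ioc (0 : ℝ) 1 := fun θ hθ =>
    ⟨hθ₁.1.trans_le hθ.1, hθ.2⟩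
  have hc : ContinuousOn (fun θ => ∑ t ∈ Finset.range T, logStat θ (G t) (s t))
      (Set.Icc θ₁ 1) := by
    refine continuousOn_finsetSum _ fun t _ => ?_
    unfold logStat
    split_ifs
    · refine ContinuousOn.log (by fun_prop) fun θ hθ => (one_sub_mul_pos (hsub θ hθ) (hx t)).ne'
    · exact ContinuousOn.log continuousOn_id fun θ hθ => (hsub θ hθ).1.ne'
  obtain ⟨θ, hθ, hmax⟩ := isCompact_Icc.exists_isMaxOn ⟨θ₁, le_rfl, hθ₁.2⟩ hc
  refine ⟨θ, hsub θ hθ, fun θ' hθ' => ?_⟩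
  rcases le_or_gt θ₁ θ' with h | h
  · exact hmax ⟨h, hθ'.2⟩
  · refine le_trans ?_ (hmax (⟨le_rfl, hθ₁.2⟩ : θ₁ ∈ Set.Icc θ₁ 1))
    have := sum_logStat_le (T := T) hx hθ₁ hθ'
    have h2 := mul_neg_of_pos_of_neg hS (sub_neg.2 h)
    simp only
    linarith

/-- Add the strict tangent bounds at the midpoint of θ and θ': the score terms cancel, and the
midpoint value is at most the maximum. -/
lemma sum_logStat_lt_of_isMaxOn (hx : ∀ t, (G t).otherShare ((G t).wGroup (s t)) < 1)
    (hd : ∃ t ∈ Finset.range T, (G t).uGroup (s t) ≠ (G t).wGroup (s t)) {θ θ' : ℝ}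
    (hθ : θ ∈ Set.Ioc (0 : ℝ) 1) (hθ' : θ' ∈ Set.Ioc (0 : ℝ) 1) (hne : θ' ≠ θ)
    (hmax : ∀ η ∈ Set.Ioc (0 : ℝ) 1, ∑ t ∈ Finset.range T, logStat η (G t) (s t) ≤
        ∑ t ∈ Finset.range T, logStat θ (G t) (s t)) :
    ∑ t ∈ Finset.range T, logStat θ' (G t) (s t) < ∑ t ∈ Finset.range T, logStat θ (G t) (s t) := by
  have hm : (θ + θ') / 2 ∈ Set.Ioc (0 : ℝ) 1 :=
    ⟨by linarith [hθ.1, hθ'.1], by linarith [hθ.2, hθ'.2]⟩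
  have h1 := sum_logStat_lt hx hm hθ (fun h => hne (by linarith)) hd
  have h2 := sum_logStat_lt hx hm hθ' (fun h => hne (by linarith)) hd
  have h3 := hmax _ hm
  nlinarith

end Maximiser

/-! ### The likelihood along a path of positive probability -/

/-- A path of the process: every graph is reachable and the groups of the first endpoints have
positive probability. -/
structure RegularPath (p : Fin K → ℝ) (n₀ : ℕ) (G₀ : Network K) (s : ℕ → Step K) : Prop where
  pos : 0 < n₀
  initNodes_eq : G₀.initNodes = n₀
  reachable : ∀ t, (G₀.run s t).Reachable p n₀ t
  wGroup_ne_zero : ∀ t, p ((G₀.run s t).wGroup (s t)) ≠ 0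

section Path

variable {p : Fin K → ℝ} {n₀ : ℕ} {G₀ : Network K} {s : ℕ → Step K}

lemma Network.Reachable.otherShare_eq {T : ℕ} {G : Network K} (hG : G.Reachable p n₀ T)
    (hn₀ : 0 < n₀) (k : Fin K) :
    G.otherShare k = 1 - (G.groupDegree k : ℝ) / (G.totalDegree : ℝ) := by
  have h : (G.totalDegree : ℝ) = G.groupDegree k + G.otherDegree k := by
    exact_mod_cast (G.groupDegree_add_otherDegree k).symm
  have h0 : (G.totalDegree : ℝ) ≠ 0 := by
    rw [hG.totalDegree_eq]
    exact_mod_cast (by omega)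
  rw [Network.otherShare, eq_sub_iff_add_eq, ← add_div, add_comm, ← h, div_self h0]

lemma RegularPath.share_eq (h : RegularPath p n₀ G₀ s) (t : ℕ) (k : Fin K) :
    share G₀ s t k = 1 - (G₀.run s t).otherShare k := by
  rw [(h.reachable t).otherShare_eq h.pos, (h.reachable t).totalDegree_eq, share, h.initNodes_eq]
  push_cast
  ring

lemma RegularPath.otherShare_pos (h : RegularPath p n₀ G₀ s) (t : ℕ) (k : Fin K) :
    0 < (G₀.run s t).otherShare k := by
  refine div_pos (by exact_mod_cast (h.reachable t).otherDegree_pos k) ?_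
  rw [(h.reachable t).totalDegree_eq]
  have := h.pos
  exact_mod_cast (by omega)

/-- With `otherShare_pos`, this keeps the arguments of all logarithms that occur positive, even at θ
= 1. -/
lemma RegularPath.otherShare_lt_one (h : RegularPath p n₀ G₀ s) (t : ℕ) :
    (G₀.run s t).otherShare ((G₀.run s t).wGroup (s t)) < 1 := by
  rw [(h.reachable t).otherShare_eq h.pos, sub_lt_self_iff]
  refine div_pos (by exact_mod_cast (h.reachable t).groupDegree_pos _ (h.wGroup_ne_zero t)) ?_
  rw [(h.reachable t).totalDegree_eq]
  have := h.pos
  exact_mod_cast (by omega)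

/-- The part of the log-likelihood of a step that does not depend on the parameters. -/
noncomputable def baseLog (G : Network K) (s : Step K) : ℝ :=
  (if s.isVertex = true then 0 else Real.log (1 - G.otherShare (G.wGroup s))) +
    (if G.uGroup s = G.wGroup s then 0 else Real.log (G.otherShare (G.wGroup s)))

lemma RegularPath.logL2_eq (h : RegularPath p n₀ G₀ s) (T : ℕ) {θ : ℝ}
    (hθ : θ ∈ Set.Ioc (0 : ℝ) 1) :
    logL2 G₀ s T θ = ∑ t ∈ Finset.range T, baseLog (G₀.run s t) (s t) +
      ∑ t ∈ Finset.range T, logStat θ (G₀.run s t) (s t) := by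
  rw [logL2, ← Finset.sum_add_distrib]
  refine Finset.sum_congr rfl fun t _ => ?_
  rw [Finset.sum_eq_single ((G₀.run s t).wGroup (s t))]
  · have hx0 := h.otherShare_pos t ((G₀.run s t).wGroup (s t))
    have hx1 := h.otherShare_lt_one t
    have hP : 1 - (G₀.run s t).otherShare ((G₀.run s t).wGroup (s t)) ≠ 0 := by linarith
    have hpos := (one_sub_mul_pos hθ hx1).ne'
    have e : ∀ x : ℝ, 1 - x + (1 - θ) * x = 1 - θ * x := fun x => by ring
    simp only [h.share_eq, sub_sub_cancel, e, SameAt, DiffAt, baseLog, logStat, true_and]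
    cases hv : (s t).isVertex <;>
      by_cases hs : (G₀.run s t).uGroup (s t) = (G₀.run s t).wGroup (s t)
    · simp [hs, Real.log_mul hP hpos]
    · simp [hs, Real.log_mul (mul_ne_zero hP hx0.ne') hθ.1.ne', Real.log_mul hP hx0.ne']
    · simp [hs]
    · simp [hs, Real.log_mul hx0.ne' hθ.1.ne']
  · intro k _ hk
    simp [SameAt, DiffAt, hk.symm]
  · simp

/-- The outcome of a step that is governed by the parameters `p` and `q`: the group of the new
node, or none in an edge-step. -/
def Network.arrival (G : Network K) (s : Step K) : Option (Fin K) :=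
  if s.isVertex = true then some (G.wGroup s) else none

/-- The law of the arrivals. -/
def arrivalLaw (p : Fin K → ℝ) (q : ℝ) : Option (Fin K) → ℝ
  | some k => q * p k
  | none => 1 - q

/-- The two factors have no parameter in common, so they are maximised separately. The arrival
factor stays a product because it may vanish on the boundary of the parameter space. -/
lemma RegularPath.likelihood_eq (h : RegularPath p n₀ G₀ s) (T : ℕ) {θ : ℝ}
    (hθ : θ ∈ Set.Ioc (0 : ℝ) 1) (p' : Fin K → ℝ) (q' : ℝ) :
    likelihood G₀ s T (θ, p', q') =
      (∏ t ∈ Finset.range T, arrivalLaw p' q' ((G₀.run s t).arrival (s t))) *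
        Real.exp (logL2 G₀ s T θ) := by
  rw [h.logL2_eq T hθ, ← Finset.sum_add_distrib, Real.exp_sum, ← Finset.prod_mul_distrib,
    likelihood]
  refine Finset.prod_congr rfl fun t _ => ?_
  rw [Finset.prod_eq_single ((G₀.run s t).wGroup (s t))]
  · have hx0 := h.otherShare_pos t ((G₀.run s t).wGroup (s t))
    have hx1 := h.otherShare_lt_one t
    have hP : 0 < 1 - (G₀.run s t).otherShare ((G₀.run s t).wGroup (s t)) := by linarith
    have hpos := one_sub_mul_pos hθ hx1
    have e : ∀ x : ℝ, 1 - x + (1 - θ) * x = 1 - θ * x := fun x => by ring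
    simp only [h.share_eq, sub_sub_cancel, e, SameAt, DiffAt, baseLog, logStat, true_and,
      Network.arrival]
    cases hv : (s t).isVertex <;>
      by_cases hs : (G₀.run s t).uGroup (s t) = (G₀.run s t).wGroup (s t)
    · simp [hs, Real.exp_add, Real.exp_log hP, Real.exp_log hpos, arrivalLaw]
    · simp [hs, Real.exp_add, Real.exp_log hP, Real.exp_log hx0, Real.exp_log hθ.1, arrivalLaw]
    · simp [hs, Real.exp_log hpos, arrivalLaw]
    · simp [hs, Real.exp_add, Real.exp_log hx0, Real.exp_log hθ.1, arrivalLaw]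
  · intro k _ hk
    simp [SameAt, DiffAt, hk.symm]
  · simp

lemma RegularPath.isThetaHat_iff (h : RegularPath p n₀ G₀ s) (T : ℕ) (θ : ℝ) :
    IsThetaHat G₀ s T θ ↔ θ ∈ Set.Ioc (0 : ℝ) 1 ∧ ∀ θ' ∈ Set.Ioc (0 : ℝ) 1,
      ∑ t ∈ Finset.range T, logStat θ' (G₀.run s t) (s t) ≤
        ∑ t ∈ Finset.range T, logStat θ (G₀.run s t) (s t) := by
  refine and_congr_right fun hθ => forall₂_congr fun θ' hθ' => ?_
  rw [h.logL2_eq T hθ, h.logL2_eq T hθ', add_le_add_iff_left]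

end Path

/-! ### Uniqueness of the maximum likelihood estimate -/

/-- **Gibbs' inequality**: the empirical distribution is the unique maximiser of the likelihood of
independent observations. -/
lemma prod_lt_prod_empirical {ι : Type*} [Fintype ι] [DecidableEq ι] (o : ℕ → ι) {T : ℕ}
    (hT : 0 < T) {r e : ι → ℝ} (hr : ∀ a, 0 ≤ r a) (hr_sum : ∑ a, r a = 1)
    (he : ∀ a, e a = (∑ t ∈ Finset.range T, if o t = a then (1 : ℝ) else 0) / T) (hne : r ≠ e) :
    ∏ t ∈ Finset.range T, r (o t) < ∏ t ∈ Finset.range T, e (o t) := by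
  have hT' : (0 : ℝ) < T := by exact_mod_cast hT
  have hcount : ∀ a, (∑ t ∈ Finset.range T, if o t = a then (1 : ℝ) else 0) = T * e a := by
    intro a
    rw [he]
    field_simp
  have he0 : ∀ a, 0 ≤ e a := by
    intro a
    rw [he]
    exact div_nonneg (Finset.sum_nonneg fun t _ => by split_ifs <;> norm_num) hT'.le
  have hepos : ∀ t ∈ Finset.range T, 0 < e (o t) := by
    intro t ht
    rw [he]
    refine div_pos (Finset.sum_pos' (fun i _ => by split_ifs <;> norm_num) ⟨t, ht, ?_⟩) hT'
    simp
  have hcomp : ∀ g : ι → ℝ, ∑ t ∈ Finset.range T, g (o t) = ∑ a, T * e a * g a := by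
    intro g
    simp only [← hcount, Finset.sum_mul]
    rw [Finset.sum_comm]
    simp
  have he_sum : ∑ a, e a = 1 := by
    have := hcomp fun _ => 1
    simp only [Finset.sum_const, Finset.card_range, nsmul_eq_mul, mul_one,
      ← Finset.mul_sum] at this
    exact (mul_left_cancel₀ hT'.ne' ((mul_one _).trans this)).symm
  -- Otherwise r agrees with e on the observed values, and e vanishes elsewhere, so e ≤ r; equal
  -- total masses then force r = e.
  have hex : ∃ t ∈ Finset.range T, r (o t) / e (o t) ≠ 1 := by
    by_contra! hall
    apply hne
    have hle : ∀ a ∈ Finset.univ, e a ≤ r a := by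
      intro a _
      by_cases ha : ∃ t ∈ Finset.range T, o t = a
      · obtain ⟨t, ht, rfl⟩ := ha
        exact ((div_eq_one_iff_eq (hepos t ht).ne').1 (hall t ht)).ge
      · push Not at ha
        have : e a = 0 := by
          rw [he, Finset.sum_eq_zero fun t ht => if_neg (ha t ht), zero_div]
        rw [this]
        exact hr a
    funext a
    exact ((Finset.sum_eq_sum_iff_of_le hle).1 (he_sum.trans hr_sum.symm) a
      (Finset.mem_univ a)).symm
  have hexp : ∀ t ∈ Finset.range T,
      r (o t) / e (o t) ≤ Real.exp (r (o t) / e (o t) - 1) := by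
    intro t _
    linarith [Real.add_one_le_exp (r (o t) / e (o t) - 1)]
  -- The ratios sum to T times the r-mass of the observed values, hence to at most T.
  have hsum : ∑ t ∈ Finset.range T, (r (o t) / e (o t) - 1) ≤ 0 := by
    rw [Finset.sum_sub_distrib, hcomp fun a => r a / e a]
    have : ∑ a, T * e a * (r a / e a) ≤ ∑ a, T * r a := by
      refine Finset.sum_le_sum fun a _ => ?_
      rcases (he0 a).eq_or_lt with h | h
      · rw [← h]
        simpa using mul_nonneg hT'.le (hr a)
      · exact le_of_eq (by field_simp)
    rw [← Finset.mul_sum, hr_sum] at this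
    simpa using this
  have hlt : ∏ t ∈ Finset.range T, r (o t) / e (o t) < 1 := by
    -- The strict comparison of products needs positive factors; a zero factor settles the claim at
    -- once.
    by_cases hz : ∃ t ∈ Finset.range T, r (o t) / e (o t) = 0
    · obtain ⟨t, ht, h0⟩ := hz
      rw [Finset.prod_eq_zero ht h0]
      exact one_pos
    · push Not at hz
      calc ∏ t ∈ Finset.range T, r (o t) / e (o t)
          < ∏ t ∈ Finset.range T, Real.exp (r (o t) / e (o t) - 1) := by
            refine Finset.prod_lt_prod (fun t ht => ?_) hexp ?_
            · exact lt_of_le_of_ne (div_nonneg (hr _) (he0 _)) (hz t ht).symm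
            · obtain ⟨t, ht, h1⟩ := hex
              refine ⟨t, ht, ?_⟩
              linarith [Real.add_one_lt_exp (sub_ne_zero.2 h1)]
        _ ≤ 1 := by
            rw [← Real.exp_sum, Real.exp_le_one_iff]
            exact hsum
  rw [Finset.prod_div_distrib, div_lt_one (Finset.prod_pos hepos)] at hlt
  exact hlt

section Path

variable {p : Fin K → ℝ} {n₀ : ℕ} {G₀ : Network K} {s : ℕ → Step K}

lemma arrival_eq_none_iff {G : Network K} {a : Step K} :
    G.arrival a = none ↔ ¬ a.isVertex = true := by
  unfold Network.arrival
  split_ifs with h <;> simp [h]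

lemma arrival_eq_some_iff {G : Network K} {a : Step K} {k : Fin K} :
    G.arrival a = some k ↔ a.isVertex = true ∧ G.wGroup a = k := by
  unfold Network.arrival
  split_ifs with h <;> simp [h]

lemma arrivalLaw_nonneg {p' : Fin K → ℝ} {q' : ℝ} (hp : ∀ k, 0 ≤ p' k)
    (hq : q' ∈ Set.Icc (0 : ℝ) 1) (a : Option (Fin K)) : 0 ≤ arrivalLaw p' q' a := by
  cases a with
  | none => exact sub_nonneg.2 hq.2
  | some k => exact mul_nonneg hq.1 (hp k)

lemma sum_arrivalLaw {p' : Fin K → ℝ} (hp : ∑ k, p' k = 1) (q' : ℝ) :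
    ∑ a, arrivalLaw p' q' a = 1 := by
  rw [Fintype.sum_option]
  simp only [arrivalLaw]
  rw [← Finset.mul_sum, hp]
  ring

/-- The empirical distribution of the arrivals is the law given by the estimators. -/
lemma arrivalLaw_estimators (hV : 0 < qHat s T) (a : Option (Fin K)) :
    arrivalLaw (pHat G₀ s T) (qHat s T) a =
      (∑ t ∈ Finset.range T, if (G₀.run s t).arrival (s t) = a then (1 : ℝ) else 0) / T := by
  have hT : (T : ℝ) ≠ 0 := by
    intro h
    rw [qHat, h, div_zero] at hV
    exact hV.false
  cases a with
  | none =>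
    simp only [arrivalLaw, qHat, arrival_eq_none_iff]
    rw [eq_div_iff hT, sub_mul, div_mul_cancel₀ _ hT, one_mul, sub_eq_iff_eq_add,
      ← Finset.sum_add_distrib]
    rw [Finset.sum_congr rfl (g := fun _ => (1 : ℝ)) fun t _ => by split_ifs <;> simp]
    simp
  | some k =>
    have hV' : (∑ t ∈ Finset.range T, if (s t).isVertex = true then (1 : ℝ) else 0) ≠ 0 := by
      intro h
      rw [qHat, h, zero_div] at hV
      exact hV.false
    simp only [arrivalLaw, qHat, pHat, arrival_eq_some_iff]
    field_simp

lemma estimators_mem_paramSpace (hV : 0 < qHat s T) {θ : ℝ} (hθ : θ ∈ Set.Ioc (0 : ℝ) 1) :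
    (θ, pHat G₀ s T, qHat s T) ∈ paramSpace K := by
  have hV' : (∑ t ∈ Finset.range T, if (s t).isVertex = true then (1 : ℝ) else 0) ≠ 0 := by
    intro h
    rw [qHat, h, zero_div] at hV
    exact hV.false
  refine ⟨hθ, ⟨fun k => ?_, ?_⟩, hV.le, ?_⟩
  · exact div_nonneg (Finset.sum_nonneg fun t _ => by split_ifs <;> norm_num)
      (Finset.sum_nonneg fun t _ => by split_ifs <;> norm_num)
  · simp only [pHat]
    rw [← Finset.sum_div, Finset.sum_comm, div_eq_one_iff_eq hV']
    refine Finset.sum_congr rfl fun t _ => ?_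
    by_cases hv : (s t).isVertex = true <;> simp [hv]
  · refine div_le_one_of_le₀ ?_ (Nat.cast_nonneg T)
    calc _ ≤ ∑ t ∈ Finset.range T, (1 : ℝ) :=
          Finset.sum_le_sum fun t _ => by split_ifs <;> norm_num
      _ = T := by simp

/-- If the competing arrival law differs from the empirical one, Gibbs' inequality is strict. If it
agrees, then q' = q̂, and p' = p̂ because q̂ > 0, so θ' ≠ θ and strict concavity decides. -/
lemma RegularPath.isUniqueMLE (h : RegularPath p n₀ G₀ s) {T : ℕ} (hV : 0 < qHat s T)
    (hd : ∃ t ∈ Finset.range T,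
      (G₀.run s t).uGroup (s t) ≠ (G₀.run s t).wGroup (s t)) {θ : ℝ}
    (hθ : IsThetaHat G₀ s T θ) : IsUniqueMLE G₀ s T (θ, pHat G₀ s T, qHat s T) := by
  have hT : 0 < T := by
    rcases Nat.eq_zero_or_pos T with h0 | h0
    · rw [h0] at hV
      simp [qHat] at hV
    · exact h0
  have hT' : (0 : ℝ) < T := by exact_mod_cast hT
  have hmem := estimators_mem_paramSpace (G₀ := G₀) hV hθ.1
  refine ⟨hmem, ?_⟩
  rintro ⟨θ', p', q'⟩ ⟨hθ', ⟨hp', hp'_sum⟩, hq'⟩ hne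
  simp only at hθ' hp' hp'_sum hq'
  rw [h.likelihood_eq T hθ', h.likelihood_eq T hθ.1]
  have hpos : 0 < ∏ t ∈ Finset.range T,
      arrivalLaw (pHat G₀ s T) (qHat s T) ((G₀.run s t).arrival (s t)) := by
    refine Finset.prod_pos fun t ht => ?_
    rw [arrivalLaw_estimators hV]
    refine div_pos (Finset.sum_pos' (fun i _ => by split_ifs <;> norm_num) ⟨t, ht, ?_⟩) hT'
    simp
  have hle : Real.exp (logL2 G₀ s T θ') ≤ Real.exp (logL2 G₀ s T θ) :=
    Real.exp_le_exp.2 (hθ.2 θ' hθ')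
  by_cases hlaw : arrivalLaw p' q' = arrivalLaw (pHat G₀ s T) (qHat s T)
  · rw [hlaw]
    refine mul_lt_mul_of_pos_left (Real.exp_lt_exp.2 ?_) hpos
    have hθne : θ' ≠ θ := by
      rintro rfl
      apply hne
      have hq : q' = qHat s T := by
        have := congrFun hlaw none
        simp only [arrivalLaw] at this
        linarith
      have hp : p' = pHat G₀ s T := by
        funext k
        have := congrFun hlaw (some k)
        simp only [arrivalLaw, hq] at this
        exact mul_left_cancel₀ hV.ne' this
      rw [hq, hp]
    rw [h.logL2_eq T hθ', h.logL2_eq T hθ.1]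
    exact add_lt_add_right (sum_logStat_lt_of_isMaxOn h.otherShare_lt_one hd hθ.1 hθ' hθne
      ((h.isThetaHat_iff T θ).1 hθ).2) _
  · refine lt_of_lt_of_le (mul_lt_mul_of_pos_right ?_ (Real.exp_pos _))
      (mul_le_mul_of_nonneg_left hle hpos.le)
    exact prod_lt_prod_empirical (fun t => (G₀.run s t).arrival (s t)) hT
      (arrivalLaw_nonneg hp' hq') (sum_arrivalLaw hp'_sum q')
      (fun a => arrivalLaw_estimators hV a) hlaw

/-- If the score is positive somewhere, then the maximiser exists. -/
lemma RegularPath.exists_isThetaHat (h : RegularPath p n₀ G₀ s) {T : ℕ} {θ₁ : ℝ}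
    (hθ₁ : θ₁ ∈ Set.Ioc (0 : ℝ) 1)
    (hS : 0 < ∑ t ∈ Finset.range T, scoreStat θ₁ (G₀.run s t) (s t)) :
    ∃ θ, IsThetaHat G₀ s T θ := by
  obtain ⟨θ, hθ, hmax⟩ := exists_isMaxOn_sum_logStat h.otherShare_lt_one hθ₁ hS
  exact ⟨θ, (h.isThetaHat_iff T θ).2 ⟨hθ, hmax⟩⟩

/-- The tangent at θ₁ has positive slope, so by concavity everything to the left of θ₁ lies strictly
below the value at θ₁. -/
lemma RegularPath.le_of_isThetaHat (h : RegularPath p n₀ G₀ s) {T : ℕ} {θ₁ θ : ℝ}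
    (hθ₁ : θ₁ ∈ Set.Ioc (0 : ℝ) 1)
    (hS : 0 < ∑ t ∈ Finset.range T, scoreStat θ₁ (G₀.run s t) (s t))
    (hθ : IsThetaHat G₀ s T θ) : θ₁ ≤ θ := by
  obtain ⟨h1, h2⟩ := (h.isThetaHat_iff T θ).1 hθ
  by_contra! hlt
  have h3 := sum_logStat_le (T := T) h.otherShare_lt_one hθ₁ h1
  have h4 := mul_neg_of_pos_of_neg hS (sub_neg.2 hlt)
  linarith [h2 θ₁ hθ₁]

lemma RegularPath.ge_of_isThetaHat (h : RegularPath p n₀ G₀ s) {T : ℕ} {θ₂ θ : ℝ}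
    (hθ₂ : θ₂ ∈ Set.Ioc (0 : ℝ) 1)
    (hS : ∑ t ∈ Finset.range T, scoreStat θ₂ (G₀.run s t) (s t) < 0)
    (hθ : IsThetaHat G₀ s T θ) : θ ≤ θ₂ := by
  obtain ⟨h1, h2⟩ := (h.isThetaHat_iff T θ).1 hθ
  by_contra! hlt
  have h3 := sum_logStat_le (T := T) h.otherShare_lt_one hθ₂ h1
  have h4 := mul_neg_of_neg_of_pos hS (sub_pos.2 hlt)
  linarith [h2 θ₂ hθ₂]

end Path

end KPA

/-! ### Drift of the score and laws of large numbers -/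

namespace KPA

variable {K : ℕ}

section Drift

variable {γ α q : ℝ} {p : Fin K → ℝ} {n₀ T : ℕ} {G : Network K}

/-- θ = 1 is excluded because the within-group score -x/(1 - x) is unbounded as x tends to 1. -/
lemma abs_scoreStat_le {θ : ℝ} (hθ : θ ∈ Set.Ioo (0 : ℝ) 1) (G : Network K) (s : Step K) :
    |scoreStat θ G s| ≤ 1 / (1 - θ) + 1 / θ := by
  have h0 : 0 < 1 - θ := sub_pos.2 hθ.2
  have h1 : 0 < θ := hθ.1
  have hx0 := G.otherShare_nonneg (G.wGroup s)
  have hx1 := G.otherShare_le_one (G.wGroup s)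
  unfold scoreStat
  split_ifs
  · have h2 : 1 - θ ≤ 1 - θ * G.otherShare (G.wGroup s) := by nlinarith
    rw [abs_neg, abs_of_nonneg (div_nonneg hx0 (h0.le.trans h2))]
    have h3 : G.otherShare (G.wGroup s) / (1 - θ * G.otherShare (G.wGroup s)) ≤ 1 / (1 - θ) :=
      div_le_div₀ zero_le_one hx1 h0 h2
    have : 0 < 1 / θ := by positivity
    linarith
  · rw [abs_of_pos (by positivity)]
    have : 0 < 1 / (1 - θ) := by positivity
    linarith

/-- A new node sees, on average, a share of the other groups that is bounded below. -/
lemma Network.Reachable.le_sum_mul_otherShare (hp_sum : ∑ k, p k = 1) (hG : G.Reachable p n₀ T)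
    (hn₀ : 0 < n₀) {m : ℝ} (hm : ∀ k, p k ≤ m) : 1 - m ≤ ∑ k, p k * G.otherShare k := by
  have h0 : (G.totalDegree : ℝ) ≠ 0 := by
    rw [hG.totalDegree_eq]
    exact_mod_cast (by omega)
  have h1 : ∑ k, (G.groupDegree k : ℝ) / (G.totalDegree : ℝ) = 1 := by
    rw [← Finset.sum_div, ← Nat.cast_sum, G.sum_groupDegree, div_self h0]
  have h2 : ∑ k, p k * G.otherShare k =
      1 - ∑ k, p k * ((G.groupDegree k : ℝ) / (G.totalDegree : ℝ)) := by
    rw [← hp_sum, ← Finset.sum_sub_distrib]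
    refine Finset.sum_congr rfl fun k _ => ?_
    rw [hG.otherShare_eq hn₀]
    ring
  have h3 : ∑ k, p k * ((G.groupDegree k : ℝ) / (G.totalDegree : ℝ)) ≤
      ∑ k, m * ((G.groupDegree k : ℝ) / (G.totalDegree : ℝ)) :=
    Finset.sum_le_sum fun k _ => mul_le_mul_of_nonneg_right (hm k) (by positivity)
  rw [← Finset.mul_sum, h1] at h3
  linarith

/-- The conditional expectation of the score has the sign of `θ* - θ` and is bounded away from
zero. -/
lemma Network.Reachable.exists_stepMean_scoreStat (hγ : γ ∈ Set.Ioc (0 : ℝ) 1)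
    (hα : α ∈ Set.Ioc (0 : ℝ) 1) (hq : q ∈ Set.Ioc (0 : ℝ) 1) (hp : ∀ k, 0 ≤ p k)
    (hp_sum : ∑ k, p k = 1) (hG : G.Reachable p n₀ T) (hn₀ : 0 < n₀) {m : ℝ}
    (hm : ∀ k, p k ≤ m) {θ : ℝ} (hθ : θ ∈ Set.Ioo (0 : ℝ) 1) :
    ∃ W, q * (1 - m) ≤ W ∧ G.stepMean γ α p q (scoreStat θ G) =
      (γ / (γ + α * (1 - γ)) - θ) / θ * W := by
  have hx : ∀ k, 0 < 1 - θ * G.otherShare k := by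
    intro k
    nlinarith [hθ.1, hθ.2, G.otherShare_nonneg k, G.otherShare_le_one k]
  -- With c = θ*, the left side is the conditional mean of the score given that the first endpoint
  -- lies in group k.
  have hH : ∀ c k, (1 - c * G.otherShare k) *
      (-(G.otherShare k / (1 - θ * G.otherShare k))) + c * G.otherShare k * (1 / θ) =
      (c - θ) / θ * (G.otherShare k / (1 - θ * G.otherShare k)) := by
    intro c k
    have h1 := (hx k).ne'
    have h2 := hθ.1.ne'
    generalize G.otherShare k = x at h1 ⊢
    have h3 : x = x / (1 - θ * x) * (1 - θ * x) := (div_mul_cancel₀ _ h1).symm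
    rw [sub_div, div_self h2]
    linear_combination (c / θ) * h3 - c * x * (x / (1 - θ * x)) * mul_inv_cancel₀ h2
  have hle : ∀ k, G.otherShare k ≤ G.otherShare k / (1 - θ * G.otherShare k) := by
    intro k
    rw [le_div_iff₀ (hx k)]
    nlinarith [mul_nonneg hθ.1.le (mul_nonneg (G.otherShare_nonneg k) (G.otherShare_nonneg k))]
  -- W is the mean of x/(1 - θx) over the group of the first endpoint. Vertex-steps alone give the
  -- lower bound; the edge-step part is merely nonnegative.
  refine ⟨q * ∑ k, p k * (G.otherShare k / (1 - θ * G.otherShare k)) +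
    (1 - q) * ∑ w ∈ Finset.range G.numNodes, G.prefProb w *
      (G.otherShare (G.group w) / (1 - θ * G.otherShare (G.group w))), ?_, ?_⟩
  · have h1 := hG.le_sum_mul_otherShare hp_sum hn₀ hm
    have h2 : ∑ k, p k * G.otherShare k ≤
        ∑ k, p k * (G.otherShare k / (1 - θ * G.otherShare k)) :=
      Finset.sum_le_sum fun k _ => mul_le_mul_of_nonneg_left (hle k) (hp k)
    have h3 : 0 ≤ (1 - q) * ∑ w ∈ Finset.range G.numNodes, G.prefProb w *
        (G.otherShare (G.group w) / (1 - θ * G.otherShare (G.group w))) := by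
      refine mul_nonneg (sub_nonneg.2 hq.2) (Finset.sum_nonneg fun w _ => mul_nonneg ?_ ?_)
      · unfold Network.prefProb
        positivity
      · exact (G.otherShare_nonneg _).trans (hle _)
    have h4 := mul_le_mul_of_nonneg_left (h1.trans h2) hq.1.le
    linarith
  · rw [hG.stepMean_eq hγ hα
      (φ := fun _ k => -(G.otherShare k / (1 - θ * G.otherShare k))) (χ := fun _ _ => 1 / θ)
      (f := scoreStat θ G) (fun s => rfl)]
    simp only [hH]
    rw [mul_add, Finset.mul_sum, Finset.mul_sum, Finset.mul_sum, Finset.mul_sum, Finset.mul_sum,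
      Finset.mul_sum]
    congr 1 <;> exact Finset.sum_congr rfl fun _ _ => by ring

lemma Network.stepMean_neg (f : Step K → ℝ) :
    G.stepMean γ α p q (fun s => -f s) = -G.stepMean γ α p q f := by
  have := Network.stepMean_add_mul (G := G) (γ := γ) (α := α) (p := p) (q := q) f 0 (-1)
  simpa using this

end Drift

namespace IsKPAModel

variable {Ω : Type*} [MeasurableSpace Ω] {μ : Measure Ω} {G₀ : Network K} {γ α q : ℝ}
  {p : Fin K → ℝ} {ξ : ℕ → Ω → Step K}

/-- The law of large numbers for a bounded statistic with constant conditional expectation. -/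
lemma ae_tendsto_mean [IsProbabilityMeasure μ] (hξ : IsKPAModel μ G₀ γ α p q ξ)
    (hγ : γ ∈ Set.Ioc (0 : ℝ) 1) (hα : α ∈ Set.Ioc (0 : ℝ) 1) (hq : q ∈ Set.Ioc (0 : ℝ) 1)
    (hp : ∀ k, 0 ≤ p k) (hp_sum : ∑ k, p k = 1) {n₀ : ℕ} (hn₀ : 0 < n₀)
    (hG₀ : G₀.Reachable p n₀ 0) (f : Network K → Step K → ℝ)
    {C c : ℝ} (hfC : ∀ G s, |f G s| ≤ C)
    (hf : ∀ (T : ℕ) (G : Network K), G.Reachable p n₀ T → G.stepMean γ α p q (f G) = c) :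
    ∀ᵐ ω ∂μ, Tendsto (fun T : ℕ =>
      (∑ t ∈ Finset.range T, f (G₀.run (fun i => ξ i ω) t) (ξ t ω)) / T) atTop (𝓝 c) := by
  have hC : 0 ≤ C := (abs_nonneg _).trans (hfC G₀ (.edgeStep 0 0))
  -- The statistic σ(f - c) - 1/(n + 1) has drift -1/(n + 1); the signs σ = ±1 give the two
  -- one-sided bounds on the average.
  have key : ∀ (σ : ℝ), |σ| = 1 → ∀ n : ℕ, ∀ᵐ ω ∂μ, ∀ᶠ T in atTop,
      ∑ t ∈ Finset.range T, ((-(σ * c) - 1 / ((n : ℝ) + 1)) +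
        σ * f (G₀.run (fun i => ξ i ω) t) (ξ t ω)) < 0 := by
    intro σ hσ n
    have hn : 0 < 1 / ((n : ℝ) + 1) := by positivity
    refine hξ.ae_eventually_sum_neg hγ hα hq hp hp_sum hn₀ hG₀
      (fun G s => (-(σ * c) - 1 / ((n : ℝ) + 1)) + σ * f G s)
      (C := |-(σ * c) - 1 / ((n : ℝ) + 1)| + C + 1) (by positivity) ?_ hn ?_
    · intro G s
      refine (abs_add_le _ _).trans ?_
      rw [abs_mul, hσ, one_mul]
      linarith [hfC G s]
    · intro T G hG
      rw [Network.stepMean_add_mul, hG.stepMean_one hγ hα hp_sum (by omega), hf T G hG]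
      linarith
  have h1 := ae_all_iff.2 (key 1 (by norm_num))
  have h2 := ae_all_iff.2 (key (-1) (by norm_num))
  filter_upwards [h1, h2] with ω hω1 hω2
  rw [Metric.tendsto_atTop']
  intro ε hε
  obtain ⟨n, hn⟩ := exists_nat_one_div_lt hε
  obtain ⟨N, hN⟩ := eventually_atTop.1 ((hω1 n).and (hω2 n))
  refine ⟨N, fun T hT => ?_⟩
  obtain ⟨hT1, hT2⟩ := hN T hT.le
  have hT0 : (0 : ℝ) < T := by exact_mod_cast (Nat.zero_le N).trans_lt hT
  rw [Finset.sum_add_distrib, ← Finset.mul_sum, Finset.sum_const, Finset.card_range,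
    nsmul_eq_mul] at hT1 hT2
  rw [Real.dist_eq, abs_lt]
  constructor
  · rw [lt_sub_iff_add_lt, lt_div_iff₀ hT0]
    nlinarith
  · rw [sub_lt_iff_lt_add, div_lt_iff₀ hT0]
    nlinarith

lemma ae_regularPath [IsFiniteMeasure μ] (hξ : IsKPAModel μ G₀ γ α p q ξ) {n₀ : ℕ}
    (hn₀ : 0 < n₀) (hinit : G₀.initNodes = n₀) (hG₀ : G₀.Reachable p n₀ 0) :
    ∀ᵐ ω ∂μ, RegularPath p n₀ G₀ fun t => ξ t ω := by
  filter_upwards [hξ.ae_reachable hG₀, hξ.ae_stepProb_ne_zero] with ω h1 h2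
  exact ⟨hn₀, hinit, h1, fun t => (h1 t).wGroup_ne_zero (h2 t)⟩

lemma ae_tendsto_qHat [IsProbabilityMeasure μ] (hξ : IsKPAModel μ G₀ γ α p q ξ)
    (hγ : γ ∈ Set.Ioc (0 : ℝ) 1) (hα : α ∈ Set.Ioc (0 : ℝ) 1) (hq : q ∈ Set.Ioc (0 : ℝ) 1)
    (hp : ∀ k, 0 ≤ p k) (hp_sum : ∑ k, p k = 1) {n₀ : ℕ} (hn₀ : 0 < n₀)
    (hG₀ : G₀.Reachable p n₀ 0) :
    ∀ᵐ ω ∂μ, Tendsto (qHat fun t => ξ t ω) atTop (𝓝 q) := by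
  refine hξ.ae_tendsto_mean hγ hα hq hp hp_sum hn₀ hG₀
    (fun _ s => if s.isVertex = true then 1 else 0) (C := 1)
    (fun G s => by split_ifs <;> simp) fun T G hG => ?_
  rw [hG.stepMean_eq_of_wGroup hγ hα (φ := fun v _ => if v = true then 1 else 0) (fun s => rfl)]
  simp [hp_sum]

lemma ae_tendsto_pHat [IsProbabilityMeasure μ] (hξ : IsKPAModel μ G₀ γ α p q ξ)
    (hγ : γ ∈ Set.Ioc (0 : ℝ) 1) (hα : α ∈ Set.Ioc (0 : ℝ) 1) (hq : q ∈ Set.Ioc (0 : ℝ) 1)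
    (hp : ∀ k, 0 ≤ p k) (hp_sum : ∑ k, p k = 1) {n₀ : ℕ} (hn₀ : 0 < n₀)
    (hG₀ : G₀.Reachable p n₀ 0) :
    ∀ᵐ ω ∂μ, Tendsto (pHat G₀ fun t => ξ t ω) atTop (𝓝 p) := by
  have h : ∀ k, ∀ᵐ ω ∂μ, Tendsto (fun T : ℕ => (∑ t ∈ Finset.range T,
      if (ξ t ω).isVertex = true ∧ (G₀.run (fun i => ξ i ω) t).wGroup (ξ t ω) = k
        then (1 : ℝ) else 0) / T) atTop (𝓝 (q * p k)) := by
    intro k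
    refine hξ.ae_tendsto_mean hγ hα hq hp hp_sum hn₀ hG₀
      (fun G s => if s.isVertex = true ∧ G.wGroup s = k then 1 else 0) (C := 1)
      (fun G s => by split_ifs <;> simp) fun T G hG => ?_
    rw [hG.stepMean_eq_of_wGroup hγ hα (φ := fun v i => if v = true ∧ i = k then 1 else 0)
      (fun s => rfl)]
    simp
  filter_upwards [ae_all_iff.2 h, hξ.ae_tendsto_qHat hγ hα hq hp hp_sum hn₀ hG₀] with ω h1 h2
  refine tendsto_pi_nhds.2 fun k => ?_
  have h3 := (h1 k).div h2 hq.1.ne'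
  rw [mul_div_cancel_left₀ _ hq.1.ne'] at h3
  refine h3.congr' ?_
  filter_upwards [eventually_gt_atTop 0] with T hT
  have hT' : (T : ℝ) ≠ 0 := by exact_mod_cast hT.ne'
  simp only [Pi.div_apply, pHat, qHat]
  exact div_div_div_cancel_right₀ hT' _ _

/-- The score is eventually positive below `θ*` and eventually negative above. -/
lemma ae_eventually_scoreStat [IsProbabilityMeasure μ] (hξ : IsKPAModel μ G₀ γ α p q ξ)
    (hγ : γ ∈ Set.Ioc (0 : ℝ) 1) (hα : α ∈ Set.Ioc (0 : ℝ) 1) (hq : q ∈ Set.Ioc (0 : ℝ) 1)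
    (hp : ∀ k, 0 ≤ p k) (hp_sum : ∑ k, p k = 1) (hp_lt : ∀ k, p k < 1) {n₀ : ℕ} (hn₀ : 0 < n₀)
    (hG₀ : G₀.Reachable p n₀ 0) {θ : ℝ} (hθ : θ ∈ Set.Ioo (0 : ℝ) 1) :
    ∀ᵐ ω ∂μ, (θ < γ / (γ + α * (1 - γ)) → ∀ᶠ T in atTop,
        0 < ∑ t ∈ Finset.range T, scoreStat θ (G₀.run (fun i => ξ i ω) t) (ξ t ω)) ∧
      (γ / (γ + α * (1 - γ)) < θ → ∀ᶠ T in atTop,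
        ∑ t ∈ Finset.range T, scoreStat θ (G₀.run (fun i => ξ i ω) t) (ξ t ω) < 0) := by
  obtain ⟨m, hm1, hm⟩ : ∃ m < 1, ∀ k, p k ≤ m := by
    have : Nonempty (Fin K) := by
      by_contra h
      rw [not_nonempty_iff] at h
      simp at hp_sum
    obtain ⟨k, hk⟩ := Finite.exists_max p
    exact ⟨p k, hp_lt k, hk⟩
  have hC : 0 < 1 / (1 - θ) + 1 / θ := by
    have h0 : 0 < 1 - θ := sub_pos.2 hθ.2
    have h1 : 0 < θ := hθ.1
    positivity
  have hW : 0 < q * (1 - m) := mul_pos hq.1 (sub_pos.2 hm1)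
  rcases lt_trichotomy θ (γ / (γ + α * (1 - γ))) with h | h | h
  · have hd : 0 < (γ / (γ + α * (1 - γ)) - θ) / θ := div_pos (sub_pos.2 h) hθ.1
    have := hξ.ae_eventually_sum_neg hγ hα hq hp hp_sum hn₀ hG₀ (fun G s => -scoreStat θ G s)
      hC (fun G s => by rw [abs_neg]; exact abs_scoreStat_le hθ G s) (mul_pos hd hW)
      (fun T G hG => by
        obtain ⟨W, hW1, hW2⟩ := hG.exists_stepMean_scoreStat hγ hα hq hp hp_sum hn₀ hm hθ
        rw [Network.stepMean_neg, hW2]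
        exact neg_le_neg (mul_le_mul_of_nonneg_left hW1 hd.le))
    filter_upwards [this] with ω hω
    refine ⟨fun _ => ?_, fun h' => absurd h h'.not_gt⟩
    filter_upwards [hω] with T hT
    rwa [Finset.sum_neg_distrib, neg_lt_zero] at hT
  · exact Eventually.of_forall fun ω => ⟨fun h' => absurd h h'.ne, fun h' => absurd h h'.ne'⟩
  · have hd : 0 < (θ - γ / (γ + α * (1 - γ))) / θ := div_pos (sub_pos.2 h) hθ.1
    have := hξ.ae_eventually_sum_neg hγ hα hq hp hp_sum hn₀ hG₀ (scoreStat θ)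
      hC (abs_scoreStat_le hθ) (mul_pos hd hW)
      (fun T G hG => by
        obtain ⟨W, hW1, hW2⟩ := hG.exists_stepMean_scoreStat hγ hα hq hp hp_sum hn₀ hm hθ
        rw [hW2, ← neg_sub θ, neg_div, neg_mul]
        exact neg_le_neg (mul_le_mul_of_nonneg_left hW1 hd.le))
    filter_upwards [this] with ω hω
    exact ⟨fun h' => absurd h h'.not_gt, fun _ => hω⟩

end IsKPAModel

end KPA

/-! ### The main theorem -/

theorem theorem4 {K : ℕ} {Ω : Type*} [MeasurableSpace Ω] (μ : Measure Ω) [IsProbabilityMeasure μ]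
    (γ α : ℝ) (hγ : γ ∈ Set.Ioc (0 : ℝ) 1) (hα : α ∈ Set.Ioc (0 : ℝ) 1)
    (p : Fin K → ℝ) (hp_nonneg : ∀ k, 0 ≤ p k) (hp_sum : ∑ k, p k = 1) (hp_lt : ∀ k, p k < 1)
    (q : ℝ) (hq : q ∈ Set.Ioc (0 : ℝ) 1)
    (n₀ : ℕ) (hn₀ : K ≤ n₀) (g₀ : ℕ → Fin K)
    (hg₀ : ∀ k, (((Finset.range n₀).filter fun i => g₀ i = k).card : ℝ) = p k * (n₀ : ℝ))
    (ξ : ℕ → Ω → KPA.Step K)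
    (hξ : KPA.IsKPAModel μ (KPA.Network.initial n₀ g₀) γ α p q ξ)
    (θstar : ℝ) (hθstar : θstar = γ / (γ + α * (1 - γ)))
    (θhat : ℕ → Ω → ℝ)
    (hθhat : ∀ T ω, (∃ θ, KPA.IsThetaHat (KPA.Network.initial n₀ g₀) (fun t => ξ t ω) T θ) →
      KPA.IsThetaHat (KPA.Network.initial n₀ g₀) (fun t => ξ t ω) T (θhat T ω)) :
    ∀ᵐ ω ∂μ,
      (∀ᶠ T in atTop,
        KPA.IsThetaHat (KPA.Network.initial n₀ g₀) (fun t => ξ t ω) T (θhat T ω) ∧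
        KPA.IsUniqueMLE (KPA.Network.initial n₀ g₀) (fun t => ξ t ω) T
          (θhat T ω, KPA.pHat (KPA.Network.initial n₀ g₀) (fun t => ξ t ω) T,
            KPA.qHat (fun t => ξ t ω) T)) ∧
      Tendsto (fun T =>
          (θhat T ω, KPA.pHat (KPA.Network.initial n₀ g₀) (fun t => ξ t ω) T,
            KPA.qHat (fun t => ξ t ω) T))
        atTop (𝓝 (θstar, p, q)) := by
  have hK : 0 < K := by
    rcases Nat.eq_zero_or_pos K with h | h
    · subst h
      simp at hp_sum
    · exact h
  have hn : 0 < n₀ := hK.trans_le hn₀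
  have hG₀ := KPA.Network.reachable_initial hp_nonneg hp_lt hn hg₀
  have hm : 0 ≤ α * (1 - γ) := mul_nonneg hα.1.le (sub_nonneg.2 hγ.2)
  have hθ0 : 0 < θstar := by
    rw [hθstar]
    exact div_pos hγ.1 (by linarith [hγ.1])
  have hθ1 : θstar ≤ 1 := by
    rw [hθstar]
    exact div_le_one_of_le₀ (by linarith) (by linarith [hγ.1])
  -- Only rational parameters are tested, so that one null set serves them all.
  have hscore := ae_all_iff.2 fun r : ℚ => ae_all_iff.2 fun hr : (r : ℝ) ∈ Set.Ioo (0 : ℝ) 1 =>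
    hξ.ae_eventually_scoreStat hγ hα hq hp_nonneg hp_sum hp_lt hn hG₀ hr
  rw [← hθstar] at hscore
  filter_upwards [hξ.ae_regularPath hn rfl hG₀, hscore,
    hξ.ae_tendsto_qHat hγ hα hq hp_nonneg hp_sum hn hG₀,
    hξ.ae_tendsto_pHat hγ hα hq hp_nonneg hp_sum hn hG₀] with ω hpath hS hqHat hpHat
  have hlow : ∀ r : ℚ, (r : ℝ) ∈ Set.Ioo (0 : ℝ) 1 → (r : ℝ) < θstar → ∀ᶠ T in atTop,
      KPA.IsThetaHat (KPA.Network.initial n₀ g₀) (fun t => ξ t ω) T (θhat T ω) ∧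
      (r : ℝ) ≤ θhat T ω ∧ ∃ t ∈ Finset.range T,
        ((KPA.Network.initial n₀ g₀).run (fun t => ξ t ω) t).uGroup (ξ t ω) ≠
          ((KPA.Network.initial n₀ g₀).run (fun t => ξ t ω) t).wGroup (ξ t ω) := by
    intro r hr hrθ
    filter_upwards [(hS r hr).1 hrθ] with T hT
    have hr' : (r : ℝ) ∈ Set.Ioc (0 : ℝ) 1 := ⟨hr.1, hr.2.le⟩
    have hhat := hθhat T ω (hpath.exists_isThetaHat hr' hT)
    exact ⟨hhat, hpath.le_of_isThetaHat hr' hT hhat,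
      KPA.exists_uGroup_ne_wGroup hpath.otherShare_lt_one hr' hT⟩
  -- A single rational below θ* already yields, for large T, a maximiser and an edge between groups.
  obtain ⟨r₀, hr₀, hr₀θ⟩ := exists_rat_btwn hθ0
  have hr₀' := hlow r₀ ⟨hr₀, hr₀θ.trans_le hθ1⟩ hr₀θ
  refine ⟨?_, ?_⟩
  · filter_upwards [hr₀', hqHat.eventually_const_lt hq.1] with T hT hqT
    exact ⟨hT.1, hpath.isUniqueMLE hqT hT.2.2 hT.1⟩
  · refine Tendsto.prodMk_nhds ?_ (hpHat.prodMk_nhds hqHat)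
    refine tendsto_order.2 ⟨fun a ha => ?_, fun a ha => ?_⟩
    · obtain ⟨r, hr, hrθ⟩ := exists_rat_btwn (max_lt ha hθ0)
      filter_upwards [hlow r ⟨(le_max_right _ _).trans_lt hr, hrθ.trans_le hθ1⟩ hrθ] with T hT
      exact ((le_max_left _ _).trans_lt hr).trans_le hT.2.1
    -- If θ* = 1 there is no test point above θ*, but the constraint θ̂ ≤ 1 gives the upper bound.
    · rcases hθ1.eq_or_lt with h1 | h1
      · filter_upwards [hr₀'] with T hT
        exact (hT.1.1.2.trans h1.ge).trans_lt ha
      · obtain ⟨r, hr, hra⟩ := exists_rat_btwn (lt_min ha h1)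
        have hr1 : (r : ℝ) ∈ Set.Ioo (0 : ℝ) 1 :=
          ⟨hθ0.trans hr, hra.trans_le (min_le_right _ _)⟩
        filter_upwards [hr₀', (hS r hr1).2 hr] with T hT hST
        exact (hpath.ge_of_isThetaHat ⟨hr1.1, hr1.2.le⟩ hST hT.1).trans_lt
          (hra.trans_le (min_le_left _ _))
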